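/- **Definitions.** All graphs (loops and parallel edges allowed) and matroids are finite. A *biased graph* $\Omega=(G,\mathcal B)$ is a graph $G$ with a collection $\mathcal B$ of cycles of $G$ (the *balanced* cycles; the other cycles are *unbalanced*) such that no theta subgraph contains exactly two balanced cycles. Its *frame matroid* $F(\Omega)$ is the matroid on $E(G)$ whose circuits are the edge sets of: balanced cycles; pairs of edge-disjoint unbalanced cycles meeting in exactly one vertex; pairs of vertex-disjoint unbalanced cycles together with a path connecting them; theta subgraphs all three of whose cycles are unbalanced. A *matroidal* $(M,L)$ is a matroid $M$ with a set $L\subseteq E(M)$. It is *frame* if there is a biased graph $\Omega$ with $M=F(\Omega)$ in which every element of $L$ that is not a loop of the matroid $M$ is an unbalanced loop of $\Omega$. A *minor* of $(M,L)$ is any matroidal obtained by a sequence of the operations: delete or contract an element not in $L$; remove an element from $L$ (keeping it in the matroid). An *excluded minor* for the class of frame matroidals is a matroidal that is not frame but all of whose proper minors are frame. For $0\le i\le 7$ let $\Omega_i$ be the following biased graph on the vertices $v,x,y$; in each of them every cycle that is not listed as balanced is unbalanced. * $\Omega_0$, $\Omega_1$: $e_1$ is a loop at $v$; $a=vx$,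 $b=vy$; $c$ and $e_2$ are two parallel links $xy$. Balanced cycles: only $\{a,b,c\}$ in $\Omega_0$; none in $\Omega_1$. * $\Omega_2$: the graph of $\Omega_1$ with an additional loop $d$ at $y$. Balanced cycle: only $\{a,b,e_2\}$. * $\Omega_3$: the graph of $\Omega_1$ with an additional link $d=xy$. Balanced cycle: only $\{a,b,e_2\}$. * $\Omega_4,\Omega_5,\Omega_6$: $e_1$ is a loop at $v$; $a,b$ are two parallel links $vx$; $c,d$ are two parallel links $vy$; $e_2=xy$. Balanced cycles: $\{a,c,e_2\}$ and $\{b,d,e_2\}$ in $\Omega_4$; only $\{a,c,e_2\}$ in $\Omega_5$; none in $\Omega_6$. * $\Omega_7$: $e_1$ is a loop at $v$; $e_2=vx$; $a,b$ are two parallel links $xy$; $c,d$ are two parallel links $vy$. Balanced cycles: $\{a,c,e_2\}$ and $\{b,d,e_2\}$. Let $M_i=F(\Omega_i)$, $L_i=\{e_1,e_2\}$ and $\mathcal M_i=(M_i,L_i)$. **Proposition.** For every $i\in\{0,\dots,7\}$ the matroid $M_i$ has rank $3$, and $\mathcal M_i$ is an excluded minor for the class of frame matroidals: $\mathcal M_i$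 is not frame, but every proper minor of $\mathcal M_i$ is frame. -/

import Mathlib

open Set

/-! ### Cycles, paths and theta subgraphs of a multigraph, given by their edge sets -/

namespace Graph

/-- The set `V(X)` of vertices incident with an edge in `X`. -/
def endVerts {V α : Type*} (G : Graph V α) (X : Set α) : Set V :=
  {x | ∃ e ∈ X, G.Inc e x}

/-- `C` is the edge set of a cycle with `n + 1` edges: distinct vertices `v 0, …, v n` and distinct
edges `e 0, …, e n` such that `e i` joins `v i` to `v (i + 1)`, indices being read cyclically.
A loop is a cycle with one edge, and two parallel links form a cycle with two edges. -/
def IsCycleSet {V α : Type*} (G : Graph V α) (C : Set α) : Prop :=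
  ∃ (n : ℕ) (v : Fin (n + 1) → V) (e : Fin (n + 1) → α),
    Function.Injective v ∧ Function.Injective e ∧
      (∀ i, G.IsLink (e i) (v i) (v (i + 1))) ∧ C = range e

/-- `P` is the edge set of a path from `x` to `y`. -/
def IsPathSet {V α : Type*} (G : Graph V α) (x y : V) (P : Set α) : Prop :=
  ∃ (n : ℕ) (v : Fin (n + 1) → V) (e : Fin n → α),
    Function.Injective v ∧ v 0 = x ∧ v (Fin.last n) = y ∧
      (∀ i : Fin n, G.IsLink (e i) (v i.castSucc) (v i.succ)) ∧ P = range e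

/-- `P`, `Q`, `R` are the edge sets of three internally disjoint paths linking two distinct
vertices, so that `P ∪ Q ∪ R` is a theta subgraph. Its cycles are `P ∪ Q`, `Q ∪ R`, `P ∪ R`. -/
def IsTheta {V α : Type*} (G : Graph V α) (P Q R : Set α) : Prop :=
  ∃ x y : V, x ≠ y ∧
    G.IsPathSet x y P ∧ G.IsPathSet x y Q ∧ G.IsPathSet x y R ∧
    Disjoint P Q ∧ Disjoint Q R ∧ Disjoint P R ∧
    G.endVerts P ∩ G.endVerts Q = {x, y} ∧
    G.endVerts Q ∩ G.endVerts R = {x, y} ∧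
    G.endVerts P ∩ G.endVerts R = {x, y}

/-- The graph whose vertices are all of `V`, whose edge set is `E`, and in which the unordered pair
of ends of the edge `e ∈ E` is `ends e`. -/
def ofEnds {V α : Type*} (E : Set α) (ends : α → Sym2 V) : Graph V α where
  vertexSet := univ
  IsLink e x y := e ∈ E ∧ ends e = s(x, y)
  edgeSet := E
  isLink_symm e _ := ⟨fun x y h ↦ ⟨h.1, h.2.trans Sym2.eq_swap⟩⟩
  eq_or_eq_of_isLink_of_isLink e x y v w h h' := by
    have := h.2.symm.trans h'.2
    rw [Sym2.eq_iff] at this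
    tauto
  edge_mem_iff_exists_isLink e := by
    refine ⟨fun h ↦ ?_, fun ⟨x, y, h⟩ ↦ h.1⟩
    obtain ⟨⟨x, y⟩, hz⟩ := Quot.exists_rep (ends e)
    exact ⟨x, y, h, hz.symm⟩
  left_mem_of_isLink _ _ _ _ := mem_univ _

theorem IsPathSet.nonempty {V α : Type*} {G : Graph V α} {x y : V} {P : Set α}
    (h : G.IsPathSet x y P) (hxy : x ≠ y) : P.Nonempty := by
  obtain ⟨n, v, e, -, h0, hl, -, rfl⟩ := h
  cases n with
  | zero => exact absurd (h0.symm.trans hl) hxy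
  | succ n => exact ⟨e 0, mem_range_self 0⟩

theorem isCycleSet_triangle {V α : Type*} {G : Graph V α} {e f g : α} {x y z : V}
    (hxy : x ≠ y) (hyz : y ≠ z) (hxz : x ≠ z) (hef : e ≠ f) (hfg : f ≠ g) (heg : e ≠ g)
    (he : G.IsLink e x y) (hf : G.IsLink f y z) (hg : G.IsLink g z x) :
    G.IsCycleSet {e, f, g} := by
  refine ⟨2, ![x, y, z], ![e, f, g], ?_, ?_, ?_, ?_⟩
  · intro i j h
    fin_cases i <;> fin_cases j <;> simp_all
  · intro i j h
    fin_cases i <;> fin_cases j <;> simp_all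
  · intro i
    fin_cases i
    · exact he
    · exact hf
    · exact hg
  · ext t
    constructor
    · rintro (rfl | rfl | rfl)
      exacts [⟨0, rfl⟩, ⟨1, rfl⟩, ⟨2, rfl⟩]
    · rintro ⟨i, rfl⟩
      fin_cases i <;> simp

end Graph

/-! ### Biased graphs and frame matroids -/

/-- A biased graph: a graph with a collection of cycles, called balanced, such that no theta
subgraph contains exactly two balanced cycles. (`IsTheta P Q R` is symmetric in `P`, `Q`, `R`.) -/
structure BiasedGraph (V α : Type*) where
  graph : Graph V α
  balanced : Set (Set α)
  isCycleSet_of_balanced : ∀ C ∈ balanced, graph.IsCycleSet C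
  theta_property : ∀ P Q R, graph.IsTheta P Q R →
    P ∪ Q ∈ balanced → Q ∪ R ∈ balanced → P ∪ R ∈ balanced

namespace BiasedGraph

/-- `C` is the edge set of an unbalanced cycle. -/
def IsUnbalancedCycle {V α : Type*} (Ω : BiasedGraph V α) (C : Set α) : Prop :=
  Ω.graph.IsCycleSet C ∧ C ∉ Ω.balanced

/-- The edge `e` is an unbalanced loop. -/
def IsUnbalancedLoop {V α : Type*} (Ω : BiasedGraph V α) (e : α) : Prop :=
  (∃ x, Ω.graph.IsLoopAt e x) ∧ {e} ∉ Ω.balanced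

/-- Tight handcuffs: two edge-disjoint unbalanced cycles meeting in exactly one vertex. -/
def IsTightHandcuff {V α : Type*} (Ω : BiasedGraph V α) (X : Set α) : Prop :=
  ∃ C D : Set α, Ω.IsUnbalancedCycle C ∧ Ω.IsUnbalancedCycle D ∧ Disjoint C D ∧
    (∃ x, Ω.graph.endVerts C ∩ Ω.graph.endVerts D = {x}) ∧ X = C ∪ D

/-- Loose handcuffs: two vertex-disjoint unbalanced cycles along with a path connecting them,
which meets each of the two cycles in exactly one of its ends. -/
def IsLooseHandcuff {V α : Type*} (Ω : BiasedGraph V α) (X : Set α) : Prop :=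
  ∃ (C D P : Set α) (x y : V), Ω.IsUnbalancedCycle C ∧ Ω.IsUnbalancedCycle D ∧
    Disjoint (Ω.graph.endVerts C) (Ω.graph.endVerts D) ∧ Ω.graph.IsPathSet x y P ∧
    Ω.graph.endVerts P ∩ Ω.graph.endVerts C = {x} ∧
    Ω.graph.endVerts P ∩ Ω.graph.endVerts D = {y} ∧ X = C ∪ P ∪ D

/-- A theta subgraph all three of whose cycles are unbalanced. -/
def IsUnbalancedTheta {V α : Type*} (Ω : BiasedGraph V α) (X : Set α) : Prop :=
  ∃ P Q R : Set α, Ω.graph.IsTheta P Q R ∧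
    P ∪ Q ∉ Ω.balanced ∧ Q ∪ R ∉ Ω.balanced ∧ P ∪ R ∉ Ω.balanced ∧ X = P ∪ Q ∪ R

/-- The circuits of the frame matroid `F(Ω)`. -/
def IsFrameCircuit {V α : Type*} (Ω : BiasedGraph V α) (X : Set α) : Prop :=
  X ∈ Ω.balanced ∨ Ω.IsTightHandcuff X ∨ Ω.IsLooseHandcuff X ∨ Ω.IsUnbalancedTheta X

/-- `M = F(Ω)`: the matroid `M` on the edge set of `Ω` has as its circuits precisely the
frame circuits of `Ω`. -/
def Represents {V α : Type*} (Ω : BiasedGraph V α) (M : Matroid α) : Prop :=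
  M.E = Ω.graph.edgeSet ∧ ∀ X, M.IsCircuit X ↔ Ω.IsFrameCircuit X

/-- At most one matroid is represented by a given biased graph. -/
theorem Represents.unique {V α : Type*} {Ω : BiasedGraph V α} {M N : Matroid α}
    (hM : Ω.Represents M) (hN : Ω.Represents N) : M = N :=
  Matroid.ext_isCircuit (hM.1.trans hN.1.symm) fun X _ ↦ (hM.2 X).trans (hN.2 X).symm

end BiasedGraph

/-! ### Matroidals -/

/-- A matroidal: a finite matroid together with a distinguished subset `L` of its elements. -/
structure Matroidal (α : Type*) where
  matroid : Matroid α
  L : Set α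
  L_subset : L ⊆ matroid.E
  ground_finite : matroid.E.Finite

namespace Matroidal

/-- A matroidal `(M, L)` is frame if `M = F(Ω)` for some finite biased graph `Ω` in which every
element of `L` is an unbalanced loop, except that an element of `L` which is a loop of the
matroid `M` (and hence, necessarily, a balanced loop of `Ω`) is tolerated. When `L` contains no
loop of `M`, this says that every element of `L` is an unbalanced loop. -/
def IsFrame {α : Type*} (X : Matroidal α) : Prop :=
  ∃ (V : Type) (Ω : BiasedGraph V α), Ω.graph.vertexSet.Finite ∧ Ω.Represents X.matroid ∧
    ∀ e ∈ X.L, ¬ X.matroid.IsLoop e → Ω.IsUnbalancedLoop e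

/-- `Y` is obtained from `X = (M, L)` by deleting or contracting an element not in `L`, or by
removing an element from `L`. -/
def MinorStep {α : Type*} (X Y : Matroidal α) : Prop :=
  (∃ e ∈ X.matroid.E \ X.L, Y.matroid = X.matroid.delete {e} ∧ Y.L = X.L) ∨
  (∃ e ∈ X.matroid.E \ X.L, Y.matroid = X.matroid.contract {e} ∧ Y.L = X.L) ∨
  (∃ e ∈ X.L, Y.matroid = X.matroid ∧ Y.L = X.L \ {e})

/-- `Y` is a minor of `X`. -/
def IsMinor {α : Type*} (Y X : Matroidal α) : Prop :=
  Relation.ReflTransGen MinorStep X Y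

/-- `X` is an excluded minor for the class `K`: it is not in `K`, but each of its proper minors
is. -/
def IsExcludedMinor {α : Type*} (K : Matroidal α → Prop) (X : Matroidal α) : Prop :=
  ¬ K X ∧ ∀ Y : Matroidal α, Y.IsMinor X → Y ≠ X → K Y

end Matroidal

/-! ### The eight biased graphs `Ω₀, …, Ω₇` -/

/-- The labels of the edges. -/
inductive Elt
  | e₁ | e₂ | a | b | c | d
  deriving DecidableEq

namespace Elt

/-- The three vertices are `v = 0`, `x = 1` and `y = 2`. The ends of the edges in
`Ω₀`, `Ω₁` and `Ω₃`, where `d` is present in `Ω₃` only. -/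
def endsA : Elt → Sym2 (Fin 3)
  | e₁ => s(0, 0)
  | e₂ => s(1, 2)
  | a => s(0, 1)
  | b => s(0, 2)
  | c => s(1, 2)
  | d => s(1, 2)

/-- The ends of the edges in `Ω₂`. -/
def endsB : Elt → Sym2 (Fin 3)
  | e₁ => s(0, 0)
  | e₂ => s(1, 2)
  | a => s(0, 1)
  | b => s(0, 2)
  | c => s(1, 2)
  | d => s(2, 2)

/-- The ends of the edges in `Ω₄`, `Ω₅` and `Ω₆`. -/
def endsC : Elt → Sym2 (Fin 3)
  | e₁ => s(0, 0)
  | e₂ => s(1, 2)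
  | a => s(0, 1)
  | b => s(0, 1)
  | c => s(0, 2)
  | d => s(0, 2)

/-- The ends of the edges in `Ω₇`. -/
def endsD : Elt → Sym2 (Fin 3)
  | e₁ => s(0, 0)
  | e₂ => s(0, 1)
  | a => s(1, 2)
  | b => s(1, 2)
  | c => s(0, 2)
  | d => s(0, 2)

end Elt

namespace BiasedGraph

/-- The biased graph with no balanced cycle on a given graph. -/
def contrabalanced {V α : Type*} (G : Graph V α) : BiasedGraph V α where
  graph := G
  balanced := ∅
  isCycleSet_of_balanced _ h := absurd h (notMem_empty _)
  theta_property _ _ _ _ h _ := absurd h (notMem_empty _)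

theorem theta_ne {V α : Type*} {G : Graph V α} {P Q R X : Set α} (h : G.IsTheta P Q R)
    (h₁ : P ∪ Q = X) (h₂ : Q ∪ R = X) : False := by
  obtain ⟨x, y, hxy, hP, -, -, hPQ, -, hPR, -⟩ := h
  obtain ⟨e, he⟩ := hP.nonempty hxy
  have : e ∈ Q ∪ R := by
    rw [h₂, ← h₁]
    exact Or.inl he
  rcases this with h | h
  · exact disjoint_left.1 hPQ he h
  · exact disjoint_left.1 hPR he h

/-- The biased graph on a given graph with exactly one balanced cycle `C`. -/
def oneBalanced {V α : Type*} (G : Graph V α) (C : Set α) (hC : G.IsCycleSet C) :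
    BiasedGraph V α where
  graph := G
  balanced := {C}
  isCycleSet_of_balanced := by
    rintro _ rfl
    exact hC
  theta_property P Q R h h₁ h₂ := (theta_ne h h₁ h₂).elim

theorem theta_ne_pair {V α : Type*} {G : Graph V α} {P Q R C D : Set α} (h : G.IsTheta P Q R)
    (z : V) (hz : ∀ e ∈ C ∩ D, ¬ G.Inc e z)
    (hzC : ∃ e ∈ C \ D, G.Inc e z) (hzD : ∃ e ∈ D \ C, G.Inc e z)
    (h₁ : P ∪ Q = C) (h₂ : Q ∪ R = D) : False := by
  obtain ⟨x, y, -, -, -, -, -, -, -, hPQ, -, hPR⟩ := h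
  obtain ⟨e, ⟨heC, heD⟩, he⟩ := hzC
  obtain ⟨f, ⟨hfD, hfC⟩, hf⟩ := hzD
  subst h₁ h₂
  have heP : e ∈ P := heC.resolve_right fun h ↦ heD (Or.inl h)
  have hfR : f ∈ R := hfD.resolve_left fun h ↦ hfC (Or.inr h)
  have hzxy : z ∈ G.endVerts P ∩ G.endVerts Q := by
    rw [hPQ, ← hPR]
    exact ⟨⟨e, heP, he⟩, ⟨f, hfR, hf⟩⟩
  obtain ⟨g, hgQ, hg⟩ := hzxy.2
  exact hz g ⟨Or.inr hgQ, Or.inl hgQ⟩ hg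

/-- The biased graph on a given graph with exactly two balanced cycles `C` and `D`, which do not
lie in a common theta subgraph since there is a vertex `z` on both that is not an end of a common
edge. -/
def twoBalanced {V α : Type*} (G : Graph V α) (C D : Set α) (hC : G.IsCycleSet C)
    (hD : G.IsCycleSet D) (z : V) (hz : ∀ e ∈ C ∩ D, ¬ G.Inc e z)
    (hzC : ∃ e ∈ C \ D, G.Inc e z) (hzD : ∃ e ∈ D \ C, G.Inc e z) : BiasedGraph V α where
  graph := G
  balanced := {C, D}
  isCycleSet_of_balanced := by
    rintro _ (rfl | rfl)
    exacts [hC, hD]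
  theta_property P Q R h h₁ h₂ := by
    rcases h₁ with h₁ | h₁ <;> rcases h₂ with h₂ | h₂
    · exact (theta_ne h h₁ h₂).elim
    · exact (theta_ne_pair h z hz hzC hzD h₁ h₂).elim
    · exact (theta_ne_pair h z (by rwa [inter_comm]) hzD hzC h₁ h₂).elim
    · exact (theta_ne h h₁ h₂).elim

open Elt Graph

/-- Edge set `{e₁, e₂, a, b, c}`; the triangle `abc` is the only balanced cycle. -/
def Omega0 : BiasedGraph (Fin 3) Elt :=
  oneBalanced (ofEnds {d}ᶜ endsA) {a, c, b} <|
    isCycleSet_triangle (x := 0) (y := 1) (z := 2) (by decide) (by decide) (by decide) (by decide)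
      (by decide) (by decide) ⟨by simp, by decide⟩ ⟨by simp, by decide⟩ ⟨by simp, by decide⟩

/-- Edge set `{e₁, e₂, a, b, c}`; no cycle is balanced. -/
def Omega1 : BiasedGraph (Fin 3) Elt :=
  contrabalanced (ofEnds {d}ᶜ endsA)

/-- `Omega1` with an additional loop `d` at `y`; the triangle `a b e₂` is the only balanced
cycle. -/
def Omega2 : BiasedGraph (Fin 3) Elt :=
  oneBalanced (ofEnds univ endsB) {a, e₂, b} <|
    isCycleSet_triangle (x := 0) (y := 1) (z := 2) (by decide) (by decide) (by decide) (by decide)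
      (by decide) (by decide) ⟨by simp, by decide⟩ ⟨by simp, by decide⟩ ⟨by simp, by decide⟩

/-- `Omega1` with an additional link `d` between `x` and `y`; the triangle `a b e₂` is the only
balanced cycle. -/
def Omega3 : BiasedGraph (Fin 3) Elt :=
  oneBalanced (ofEnds univ endsA) {a, e₂, b} <|
    isCycleSet_triangle (x := 0) (y := 1) (z := 2) (by decide) (by decide) (by decide) (by decide)
      (by decide) (by decide) ⟨by simp, by decide⟩ ⟨by simp, by decide⟩ ⟨by simp, by decide⟩

/-- The balanced cycles are `a c e₂` and `b d e₂`. -/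
def Omega4 : BiasedGraph (Fin 3) Elt :=
  twoBalanced (ofEnds univ endsC) {a, e₂, c} {b, e₂, d}
    (isCycleSet_triangle (x := 0) (y := 1) (z := 2) (by decide) (by decide) (by decide) (by decide)
      (by decide) (by decide) ⟨by simp, by decide⟩ ⟨by simp, by decide⟩ ⟨by simp, by decide⟩)
    (isCycleSet_triangle (x := 0) (y := 1) (z := 2) (by decide) (by decide) (by decide) (by decide)
      (by decide) (by decide) ⟨by simp, by decide⟩ ⟨by simp, by decide⟩ ⟨by simp, by decide⟩)
    0
    (by
      rintro e ⟨rfl | rfl | rfl, h⟩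
      · simp at h
      · rintro ⟨w, -, hw⟩
        revert hw
        revert w
        decide
      · simp at h)
    ⟨a, by simp, 1, by simp, by decide⟩ ⟨b, by simp, 1, by simp, by decide⟩

/-- The triangle `a c e₂` is the only balanced cycle. -/
def Omega5 : BiasedGraph (Fin 3) Elt :=
  oneBalanced (ofEnds univ endsC) {a, e₂, c} <|
    isCycleSet_triangle (x := 0) (y := 1) (z := 2) (by decide) (by decide) (by decide) (by decide)
      (by decide) (by decide) ⟨by simp, by decide⟩ ⟨by simp, by decide⟩ ⟨by simp, by decide⟩

/-- No cycle is balanced. -/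
def Omega6 : BiasedGraph (Fin 3) Elt :=
  contrabalanced (ofEnds univ endsC)

/-- The balanced cycles are `a c e₂` and `b d e₂`. -/
def Omega7 : BiasedGraph (Fin 3) Elt :=
  twoBalanced (ofEnds univ endsD) {e₂, a, c} {e₂, b, d}
    (isCycleSet_triangle (x := 0) (y := 1) (z := 2) (by decide) (by decide) (by decide) (by decide)
      (by decide) (by decide) ⟨by simp, by decide⟩ ⟨by simp, by decide⟩ ⟨by simp, by decide⟩)
    (isCycleSet_triangle (x := 0) (y := 1) (z := 2) (by decide) (by decide) (by decide) (by decide)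
      (by decide) (by decide) ⟨by simp, by decide⟩ ⟨by simp, by decide⟩ ⟨by simp, by decide⟩)
    2
    (by
      rintro e ⟨rfl | rfl | rfl, h⟩
      · rintro ⟨w, -, hw⟩
        revert hw
        revert w
        decide
      · simp at h
      · simp at h)
    ⟨a, by simp, 1, by simp, by decide⟩ ⟨b, by simp, 1, by simp, by decide⟩

/-- The biased graphs `Ω₀, …, Ω₇`. -/
def Omega : Fin 8 → BiasedGraph (Fin 3) Elt :=
  ![Omega0, Omega1, Omega2, Omega3, Omega4, Omega5, Omega6, Omega7]

end BiasedGraph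

/-! Each `M_i` is a simple matroid of rank three given by its three-element lines: its circuits are
these lines and the four-element sets that contain none of them (`Matroid.ofLines`, `lineMatroid`).
That `Ω_i` represents it is a finite computation (`represents_Omega`).

`not_isFrame_lineMatroidal`: suppose that a biased graph represents `M_i` with `e₁`, `e₂` as
unbalanced loops at `u₁`, `u₂`. A circuit `{e₁, e₂, f, g}` must be a pair of loose handcuffs with
path `f`, `g` from `u₁` to `u₂`, so exactly one of `f`, `g` is incident with `u₁`. A circuit `{e₁,
f, g}` with `f`, `g` links must be tight handcuffs, so both links are incident with `u₁`. If `{e₁,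
e₂, f, k}` and `{e₁, e₂, g, k}` are circuits and `{e₁, f, g}` is independent, then `k` is incident
with `u₁`: otherwise `f` and `g` would be parallel links at `u₁`, which are dependent together with
the loop `e₁`. `IsFrame.exists_incidence` extracts these three rules, and in each of the eight
matroids a few instances of them contradict each other.

Proper minors are frame: a matroid of rank at most two is represented on two vertices, with any two
prescribed nonloops as unbalanced loops (`isFrame_of_eRank_le_two`). Hence contracting a nonloop in
rank at most three always yields a frame matroidal. Deletion and removal from `L` preserve frame
matroidals, so those of rank at most three with at most two distinguished elements are closed under
minors (`MinorStep.isFrame`). It remains to treat a single step from `(M_i, L_i)`: contraction drops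
the rank to two, removing `e₂` from `L` leaves `Ω_i` itself as a witness, and the deletions and the
removal of `e₁` are witnessed by tabulated graphs on three vertices.

A graph and a matroid determine which cycles have to be balanced, namely those that are circuits.
Thus a table of ends is a complete certificate, and it is checked by enumerating all frame circuits
with edge sets coded as bit masks. -/

namespace Graph

/-! ### Small cycles and paths, and the role of loops in them. -/

variable {V α : Type*} {G : Graph V α}

theorem isCycleSet_singleton {e : α} {x : V} (h : G.IsLoopAt e x) : G.IsCycleSet {e} := by
  refine ⟨0, fun _ ↦ x, fun _ ↦ e, fun i j _ ↦ Subsingleton.elim (α := Fin 1) i j,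
    fun i j _ ↦ Subsingleton.elim (α := Fin 1) i j, fun _ ↦ h, ?_⟩
  simp

theorem isCycleSet_pair {e f : α} {x y : V} (hef : e ≠ f) (hxy : x ≠ y) (he : G.IsLink e x y)
    (hf : G.IsLink f x y) : G.IsCycleSet {e, f} := by
  refine ⟨1, ![x, y], ![e, f], ?_, ?_, ?_, ?_⟩
  · intro i j h
    fin_cases i <;> fin_cases j <;> simp_all
  · intro i j h
    fin_cases i <;> fin_cases j <;> simp_all
  · intro i
    fin_cases i
    · exact he
    · exact hf.symm
  · simp [Matrix.range_cons, Matrix.range_empty, pair_comm]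

theorem isPathSet_singleton {e : α} {x y : V} (hxy : x ≠ y) (he : G.IsLink e x y) :
    G.IsPathSet x y {e} := by
  refine ⟨1, ![x, y], ![e], ?_, rfl, rfl, ?_, ?_⟩
  · intro i j h
    fin_cases i <;> fin_cases j <;> simp_all
  · intro i
    fin_cases i
    exact he
  · simp [Matrix.range_cons, Matrix.range_empty]

theorem isPathSet_pair {e f : α} {x y z : V} (hxz : x ≠ z) (hzy : z ≠ y) (hxy : x ≠ y)
    (he : G.IsLink e x z) (hf : G.IsLink f z y) : G.IsPathSet x y {e, f} := by
  refine ⟨2, ![x, z, y], ![e, f], ?_, rfl, rfl, ?_, ?_⟩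
  · intro i j h
    fin_cases i <;> fin_cases j <;> simp_all
  · intro i
    fin_cases i
    · exact he
    · exact hf
  · simp [Matrix.range_cons, Matrix.range_empty, pair_comm]

/-- A cycle is a loop, or a pair of parallel links, or has at least three edges. -/
theorem IsCycleSet.cases {C : Set α} (hC : G.IsCycleSet C) :
    (∃ e x, G.IsLoopAt e x ∧ C = {e}) ∨
    (∃ e f x y, e ≠ f ∧ x ≠ y ∧ G.IsLink e x y ∧ G.IsLink f x y ∧ C = {e, f}) ∨
    ∃ (n : ℕ) (v : Fin (n + 3) → V) (e : Fin (n + 3) → α), Function.Injective v ∧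
      Function.Injective e ∧ (∀ i, G.IsLink (e i) (v i) (v (i + 1))) ∧ C = range e := by
  obtain ⟨n, v, e, hv, he, hl, rfl⟩ := hC
  match n, v, e, hv, he, hl with
  | 0, v, e, hv, he, hl =>
    refine .inl ⟨e 0, v 0, hl 0, ?_⟩
    ext t
    simp [eq_comm]
  | 1, v, e, hv, he, hl =>
    refine .inr (.inl ⟨e 0, e 1, v 0, v 1, he.ne (by decide), hv.ne (by decide), hl 0,
      (hl 1).symm, ?_⟩)
    ext t
    simp [Fin.exists_fin_two, eq_comm]
  | n + 2, v, e, hv, he, hl => exact .inr (.inr ⟨n, v, e, hv, he, hl, rfl⟩)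

/-- A path has no edge, one edge, two edges or at least three edges. -/
theorem IsPathSet.cases {x y : V} {P : Set α} (hP : G.IsPathSet x y P) :
    (x = y ∧ P = ∅) ∨ (x ≠ y ∧ ∃ e, G.IsLink e x y ∧ P = {e}) ∨
    (∃ z e f, x ≠ z ∧ z ≠ y ∧ x ≠ y ∧ G.IsLink e x z ∧ G.IsLink f z y ∧ P = {e, f}) ∨
    ∃ (n : ℕ) (v : Fin (n + 4) → V) (e : Fin (n + 3) → α), Function.Injective v ∧
      v 0 = x ∧ v (Fin.last _) = y ∧
      (∀ i : Fin (n + 3), G.IsLink (e i) (v i.castSucc) (v i.succ)) ∧ P = range e := by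
  obtain ⟨n, v, e, hv, h0, h1, hl, rfl⟩ := hP
  match n, v, e, hv, h0, h1, hl with
  | 0, v, e, hv, h0, h1, hl => exact .inl ⟨h0.symm.trans h1, range_eq_empty e⟩
  | 1, v, e, hv, h0, h1, hl =>
    subst h0 h1
    refine .inr (.inl ⟨hv.ne (by decide), e 0, hl 0, ?_⟩)
    ext t
    simp [eq_comm]
  | 2, v, e, hv, h0, h1, hl =>
    subst h0 h1
    refine .inr (.inr (.inl ⟨v 1, e 0, e 1, hv.ne (by decide), hv.ne (by decide),
      hv.ne (by decide), hl 0, hl 1, ?_⟩))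
    ext t
    simp [Fin.exists_fin_two, eq_comm]
  | n + 3, v, e, hv, h0, h1, hl => exact .inr (.inr (.inr ⟨n, v, e, hv, h0, h1, hl, rfl⟩))

/-- At a loop the consecutive vertices `v i` and `v (i + 1)` coincide, so `i = i + 1` by
injectivity; cyclically this happens only when the cycle has one edge. -/
theorem IsCycleSet.eq_singleton {C : Set α} (hC : G.IsCycleSet C) {e : α} {x : V} (he : e ∈ C)
    (hx : G.IsLoopAt e x) : C = {e} := by
  obtain ⟨n, v, f, hv, -, hl, rfl⟩ := hC
  obtain ⟨i, rfl⟩ := he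
  have h : v i = v (i + 1) := by
    rw [← hx.eq_of_inc (hl i).inc_left, ← hx.eq_of_inc (hl i).inc_right]
  have h1 : i = i + 1 := hv h
  cases n with
  | zero =>
    ext t
    simp [Subsingleton.elim (α := Fin 1) i 0, eq_comm]
  | succ n => simp at h1

theorem IsPathSet.not_isLoopAt {x y z : V} {P : Set α} (hP : G.IsPathSet x y P) {e : α}
    (he : e ∈ P) : ¬ G.IsLoopAt e z := by
  obtain ⟨n, v, f, hv, -, -, hl, rfl⟩ := hP
  obtain ⟨i, rfl⟩ := he
  intro hz
  have h : v i.castSucc = v i.succ := by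
    rw [← hz.eq_of_inc (hl i).inc_left, ← hz.eq_of_inc (hl i).inc_right]
  exact (Fin.castSucc_lt_succ (i := i)).ne (hv h)

theorem endVerts_singleton {e : α} {x y : V} (h : G.IsLink e x y) : G.endVerts {e} = {x, y} := by
  ext z
  constructor
  · rintro ⟨_, rfl, hz⟩
    exact hz.eq_or_eq_of_isLink h
  · rintro (rfl | rfl)
    exacts [⟨e, rfl, h.inc_left⟩, ⟨e, rfl, h.inc_right⟩]

theorem IsLoopAt.endVerts_eq {e : α} {x : V} (h : G.IsLoopAt e x) : G.endVerts {e} = {x} := by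
  rw [endVerts_singleton h, pair_eq_singleton]

theorem endVerts_mono {X Y : Set α} (h : X ⊆ Y) : G.endVerts X ⊆ G.endVerts Y :=
  fun _ ⟨e, he, hx⟩ ↦ ⟨e, h he, hx⟩

/-- An injective family of at least three elements is not contained in a pair. -/
theorem not_range_subset_pair {n : ℕ} {e : Fin (n + 3) → α} (he : Function.Injective e)
    (f g : α) : ¬ range e ⊆ {f, g} := by
  intro h
  have h0 := h (mem_range_self 0)
  have h1 := h (mem_range_self 1)
  have h2 := h (mem_range_self 2)
  have h01 : e 0 ≠ e 1 := he.ne (by simp)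
  have h02 : e 0 ≠ e 2 := he.ne (by simp [Fin.ext_iff, Nat.mod_eq_of_lt])
  have h12 : e 1 ≠ e 2 := he.ne (by simp [Fin.ext_iff, Nat.mod_eq_of_lt])
  simp only [mem_insert_iff, mem_singleton_iff] at h0 h1 h2
  grind

/-- A cycle without loops contained in a pair is that pair, consisting of parallel links. -/
theorem IsCycleSet.of_subset_pair {C : Set α} (hC : G.IsCycleSet C) {f g : α} (h : C ⊆ {f, g})
    (hf : ∀ x, ¬ G.IsLoopAt f x) (hg : ∀ x, ¬ G.IsLoopAt g x) :
    C = {f, g} ∧ ∃ s t, s ≠ t ∧ G.IsLink f s t ∧ G.IsLink g s t := by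
  obtain ⟨e, x, he, rfl⟩ | ⟨e, e', x, y, hne, hxy, he, he', rfl⟩ | ⟨n, v, e, -, he, -, rfl⟩ :=
    hC.cases
  · obtain rfl | rfl := h rfl
    exacts [(hf x he).elim, (hg x he).elim]
  · have h1 := h (mem_insert e {e'})
    have h2 := h (mem_insert_of_mem e rfl)
    simp only [mem_insert_iff, mem_singleton_iff] at h1 h2
    obtain rfl | rfl := h1 <;> obtain rfl | rfl := h2
    · exact (hne rfl).elim
    · exact ⟨rfl, x, y, hxy, he, he'⟩
    · exact ⟨pair_comm _ _, x, y, hxy, he', he⟩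
    · exact (hne rfl).elim
  · exact (not_range_subset_pair he f g h).elim

/-- A path whose edges form a pair has an inner vertex. -/
theorem IsPathSet.of_eq_pair {x y : V} {f g : α} (hfg : f ≠ g) (hP : G.IsPathSet x y {f, g}) :
    ∃ t, x ≠ t ∧ t ≠ y ∧ x ≠ y ∧
      (G.IsLink f x t ∧ G.IsLink g t y ∨ G.IsLink g x t ∧ G.IsLink f t y) := by
  obtain ⟨-, h⟩ | ⟨-, e, -, h⟩ | ⟨t, e, e', h1, h2, h3, he, he', h⟩ | ⟨n, v, e, hv, -, -, hl, h⟩ :=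
    hP.cases
  · exact absurd h (insert_nonempty f {g}).ne_empty
  · have h1 : f ∈ ({e} : Set α) := h ▸ mem_insert f {g}
    have h2 : g ∈ ({e} : Set α) := h ▸ mem_insert_of_mem f rfl
    exact (hfg (h1.trans h2.symm)).elim
  · refine ⟨t, h1, h2, h3, ?_⟩
    obtain ⟨rfl, rfl⟩ | ⟨rfl, rfl⟩ := pair_eq_pair_iff.1 h
    exacts [.inl ⟨he, he'⟩, .inr ⟨he, he'⟩]
  -- The definition of a path asks only for distinct vertices. A repeated edge would have the same
  -- ends in both positions, and read in reverse order this would give `i = j + 1` and `j = i + 1`.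
  · have he : Function.Injective e := by
      intro i j hij
      have hi := hl i
      rw [hij] at hi
      obtain ⟨h, -⟩ | ⟨h, h'⟩ := hi.eq_and_eq_or_eq_and_eq (hl j)
      · exact Fin.castSucc_injective _ (hv h)
      · have h := congrArg Fin.val (hv h)
        have h' := congrArg Fin.val (hv h')
        simp only [Fin.val_castSucc, Fin.val_succ] at h h'
        omega
    exact (not_range_subset_pair he f g h.ge).elim

theorem IsTheta.not_isLoopAt {P Q R : Set α} (h : G.IsTheta P Q R) {e : α} {z : V}
    (he : e ∈ P ∪ Q ∪ R) : ¬ G.IsLoopAt e z := by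
  obtain ⟨x, y, -, hP, hQ, hR, -⟩ := h
  obtain (he | he) | he := he
  exacts [hP.not_isLoopAt he, hQ.not_isLoopAt he, hR.not_isLoopAt he]

end Graph

/-! ### Frame circuits through an unbalanced loop. -/

namespace BiasedGraph

variable {V α : Type*} {Ω : BiasedGraph V α}

/-- A frame circuit with at least two elements, one of which is an unbalanced loop, is a pair of
handcuffs, and the loop is one of its two cycles. -/
theorem IsFrameCircuit.exists_of_mem_loop {X : Set α} (hX : Ω.IsFrameCircuit X) {e : α} {u : V}
    (he : Ω.graph.IsLoopAt e u) (heu : {e} ∉ Ω.balanced) (heX : e ∈ X) :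
    ∃ D, Ω.IsUnbalancedCycle D ∧ e ∉ D ∧
      (u ∈ Ω.graph.endVerts D ∧ X = insert e D ∨
        u ∉ Ω.graph.endVerts D ∧ ∃ P y, (Ω.graph.IsPathSet u y P ∨ Ω.graph.IsPathSet y u P) ∧
          u ≠ y ∧ u ∈ Ω.graph.endVerts P ∧ Ω.graph.endVerts P ∩ Ω.graph.endVerts D = {y} ∧
          e ∉ P ∧ X = insert e (P ∪ D)) := by
  obtain hX | ⟨C, D, hC, hD, hCD, ⟨x, hx⟩, rfl⟩ | ⟨C, D, P, x, y, hC, hD, hCD, hP, hx, hy, rfl⟩ |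
    ⟨P, Q, R, h, -, -, -, rfl⟩ := hX
  · rw [(Ω.isCycleSet_of_balanced _ hX).eq_singleton heX he] at hX
    exact (heu hX).elim
  · have hxC : x ∈ Ω.graph.endVerts C ∩ Ω.graph.endVerts D := by rw [hx]; rfl
    obtain heC | heD := heX
    · obtain rfl := hC.1.eq_singleton heC he
      rw [he.endVerts_eq] at hxC
      obtain ⟨rfl, hxD⟩ := hxC
      exact ⟨D, hD, fun h ↦ disjoint_left.1 hCD rfl h, .inl ⟨hxD, rfl⟩⟩
    · obtain rfl := hD.1.eq_singleton heD he
      rw [he.endVerts_eq] at hxC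
      obtain ⟨hxC, rfl⟩ := hxC
      exact ⟨C, hC, fun h ↦ disjoint_left.1 hCD h rfl, .inl ⟨hxC, by rw [union_comm]; rfl⟩⟩
  · have hxP : x ∈ Ω.graph.endVerts P ∩ Ω.graph.endVerts C := by rw [hx]; rfl
    have hyP : y ∈ Ω.graph.endVerts P ∩ Ω.graph.endVerts D := by rw [hy]; rfl
    have hxy : x ≠ y := by
      rintro rfl
      exact disjoint_left.1 hCD hxP.2 hyP.2
    -- The loop may be either of the two cycles joined by `P`, which is why the conclusion allows
    -- both directions of the path.
    have heP : e ∉ P := fun h ↦ hP.not_isLoopAt h he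
    obtain (heC | heP') | heD := heX
    · obtain rfl := hC.1.eq_singleton heC he
      rw [he.endVerts_eq] at hxP hCD
      obtain ⟨hxP, rfl⟩ := hxP
      have huD := disjoint_singleton_left.1 hCD
      refine ⟨D, hD, fun h ↦ huD ⟨e, h, he.inc⟩, .inr ⟨huD, P, y, .inl hP, hxy, hxP, hy, heP, ?_⟩⟩
      rw [union_assoc, singleton_union]
    · exact (heP heP').elim
    · obtain rfl := hD.1.eq_singleton heD he
      rw [he.endVerts_eq] at hyP hCD
      obtain ⟨hyP, rfl⟩ := hyP
      have huC := disjoint_singleton_right.1 hCD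
      refine ⟨C, hC, fun h ↦ huC ⟨e, h, he.inc⟩,
        .inr ⟨huC, P, x, .inr hP, hxy.symm, hyP, hx, heP, ?_⟩⟩
      rw [union_singleton, union_comm]
  · exact (h.not_isLoopAt heX he).elim

/-- A frame circuit consisting of two unbalanced loops and two other edges is a pair of loose
handcuffs. -/
theorem IsFrameCircuit.exists_path {e₁ e₂ f g : α} {u₁ u₂ : V}
    (hX : Ω.IsFrameCircuit {e₁, e₂, f, g}) (h₁ : Ω.graph.IsLoopAt e₁ u₁)
    (h₂ : Ω.graph.IsLoopAt e₂ u₂) (hu₁ : {e₁} ∉ Ω.balanced)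
    (he : e₁ ≠ e₂) (hfg : f ≠ g) (hf₁ : f ≠ e₁) (hf₂ : f ≠ e₂) (hg₁ : g ≠ e₁) (hg₂ : g ≠ e₂) :
    ∃ t, t ≠ u₁ ∧ t ≠ u₂ ∧ u₁ ≠ u₂ ∧
      (Ω.graph.IsLink f u₁ t ∧ Ω.graph.IsLink g t u₂ ∨
        Ω.graph.IsLink g u₁ t ∧ Ω.graph.IsLink f t u₂) := by
  obtain ⟨D, hD, heD, ⟨hu, h⟩ | ⟨hu, P, y, hP, huy, huP, hy, heP, h⟩⟩ :=
    hX.exists_of_mem_loop h₁ hu₁ (mem_insert _ _)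
  -- A cycle through the loop `e₂` is `{e₂}`, so tight handcuffs would leave no room for `f`.
  · have h2 : e₂ ∈ D := by
      have : e₂ ∈ insert e₁ D := h ▸ (by simp)
      exact this.resolve_left he.symm
    obtain rfl := hD.1.eq_singleton h2 h₂
    have hf := h ▸ (by simp : f ∈ ({e₁, e₂, f, g} : Set α))
    simp [hf₁, hf₂] at hf
  · have h2 : e₂ ∈ P ∪ D := by
      have : e₂ ∈ insert e₁ (P ∪ D) := h ▸ (by simp)
      exact this.resolve_left he.symm
    have h2P : e₂ ∉ P := fun h' ↦ hP.elim (fun hP ↦ hP.not_isLoopAt h' h₂)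
      (fun hP ↦ hP.not_isLoopAt h' h₂)
    obtain rfl := hD.1.eq_singleton (h2.resolve_left h2P) h₂
    have hyD : y ∈ Ω.graph.endVerts P ∩ Ω.graph.endVerts {e₂} := by rw [hy]; rfl
    rw [h₂.endVerts_eq] at hyD
    obtain ⟨-, rfl⟩ := hyD
    have hPfg : P = {f, g} := by
      ext t
      have ht := Set.ext_iff.1 h t
      simp only [mem_insert_iff, mem_union, mem_singleton_iff] at ht ⊢
      grind
    subst hPfg
    obtain hP | hP := hP
    · obtain ⟨t, h1, h2, h3, h4⟩ := hP.of_eq_pair hfg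
      exact ⟨t, h1.symm, h2, h3, h4⟩
    · obtain ⟨t, h1, h2, h3, ⟨h4, h5⟩ | ⟨h4, h5⟩⟩ := hP.of_eq_pair hfg
      · exact ⟨t, h2, h1.symm, h3.symm, .inr ⟨h5.symm, h4.symm⟩⟩
      · exact ⟨t, h2, h1.symm, h3.symm, .inl ⟨h5.symm, h4.symm⟩⟩

/-- A frame circuit consisting of an unbalanced loop and two links is a pair of tight
handcuffs. -/
theorem IsFrameCircuit.inc_of_isLoopAt {e f g : α} {u : V} (hX : Ω.IsFrameCircuit {e, f, g})
    (he : Ω.graph.IsLoopAt e u) (heu : {e} ∉ Ω.balanced) (hf : ∀ x, ¬ Ω.graph.IsLoopAt f x)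
    (hg : ∀ x, ¬ Ω.graph.IsLoopAt g x) : Ω.graph.Inc f u ∧ Ω.graph.Inc g u := by
  obtain ⟨D, hD, heD, ⟨hu, h⟩ | ⟨hu, P, y, hP, huy, huP, hy, heP, h⟩⟩ :=
    hX.exists_of_mem_loop he heu (mem_insert _ _)
  · have hDfg : D ⊆ {f, g} := fun t ht ↦
      (h ▸ mem_insert_of_mem e ht : t ∈ ({e, f, g} : Set α)).resolve_left
        fun h ↦ heD (h ▸ ht)
    obtain ⟨rfl, s, t, -, hf', hg'⟩ := hD.1.of_subset_pair hDfg hf hg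
    obtain ⟨i, rfl | rfl, hi⟩ := hu
    · obtain rfl | rfl := hi.eq_or_eq_of_isLink hf'
      exacts [⟨hf'.inc_left, hg'.inc_left⟩, ⟨hf'.inc_right, hg'.inc_right⟩]
    · obtain rfl | rfl := hi.eq_or_eq_of_isLink hg'
      exacts [⟨hf'.inc_left, hg'.inc_left⟩, ⟨hf'.inc_right, hg'.inc_right⟩]
  · have hDfg : P ∪ D ⊆ {f, g} := fun t ht ↦
      (h ▸ mem_insert_of_mem e ht : t ∈ ({e, f, g} : Set α)).resolve_left fun h ↦
        ht.elim (fun ht ↦ heP (h ▸ ht)) (fun ht ↦ heD (h ▸ ht))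
    -- The cycle `D` already uses both `f` and `g`, so the edges of the path lie in `D` and `u`
    -- would be a vertex of `D`.
    obtain ⟨rfl, -⟩ := hD.1.of_subset_pair (subset_union_right.trans hDfg) hf hg
    exact (hu (Graph.endVerts_mono (subset_union_left.trans hDfg) huP)).elim

/-- Two parallel links and an unbalanced loop at one of their ends are dependent. -/
theorem exists_isFrameCircuit_of_parallel {e f g : α} {u t : V} (he : Ω.graph.IsLoopAt e u)
    (heu : {e} ∉ Ω.balanced) (hut : u ≠ t) (hfg : f ≠ g) (hf : Ω.graph.IsLink f u t)
    (hg : Ω.graph.IsLink g u t) : ∃ C ⊆ {e, f, g}, Ω.IsFrameCircuit C := by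
  have hC := Graph.isCycleSet_pair hfg hut hf hg
  -- If the two-edge cycle is balanced, it is a circuit by itself; otherwise it forms tight
  -- handcuffs with the loop.
  by_cases hb : {f, g} ∈ Ω.balanced
  · exact ⟨{f, g}, subset_insert _ _, .inl hb⟩
  refine ⟨{e, f, g}, Subset.rfl, .inr (.inl ⟨{e}, {f, g},
    ⟨Graph.isCycleSet_singleton he, heu⟩, ⟨hC, hb⟩, ?_, ⟨u, ?_⟩, rfl⟩)⟩
  · rw [disjoint_singleton_left]
    rintro (rfl | rfl)
    · exact hut (he.eq_of_inc hf.inc_right)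
    · exact hut (he.eq_of_inc hg.inc_right)
  · rw [he.endVerts_eq, inter_eq_left, singleton_subset_iff]
    exact ⟨f, mem_insert _ _, hf.inc_left⟩

end BiasedGraph

/-! ### The obstruction to being frame. -/

namespace Matroidal

open BiasedGraph

variable {α : Type*}

/-- The relations that two distinguished elements `e₁`, `e₂` of a frame matroidal impose on the
other elements: the predicate `p` says which elements are incident with the vertex of `e₁`. -/
theorem IsFrame.exists_incidence {X : Matroidal α} (hX : X.IsFrame) {e₁ e₂ : α} (h₁ : e₁ ∈ X.L)
    (h₂ : e₂ ∈ X.L) (h : X.matroid.Indep {e₁, e₂}) (hne : e₁ ≠ e₂) :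
    ∃ p : α → Prop,
      (∀ f g, f ≠ g → f ∉ ({e₁, e₂} : Set α) → g ∉ ({e₁, e₂} : Set α) →
        X.matroid.IsCircuit {e₁, e₂, f, g} → (p f ↔ ¬ p g)) ∧
      (∀ f g f' g', f ≠ f' → g ≠ g' → f ∉ ({e₁, e₂} : Set α) → g ∉ ({e₁, e₂} : Set α) →
        f' ∉ ({e₁, e₂} : Set α) → g' ∉ ({e₁, e₂} : Set α) →
        X.matroid.IsCircuit {e₁, e₂, f, f'} → X.matroid.IsCircuit {e₁, e₂, g, g'} →
        X.matroid.IsCircuit {e₁, f, g} → p f ∧ p g) ∧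
      (∀ f g k, f ≠ g → f ≠ k → g ≠ k → f ∉ ({e₁, e₂} : Set α) → g ∉ ({e₁, e₂} : Set α) →
        k ∉ ({e₁, e₂} : Set α) →
        X.matroid.IsCircuit {e₁, e₂, f, k} → X.matroid.IsCircuit {e₁, e₂, g, k} →
        X.matroid.Indep {e₁, f, g} → p k) := by
  obtain ⟨V, Ω, -, ⟨-, hΩ⟩, hL⟩ := hX
  obtain ⟨⟨u₁, hu₁⟩, hb₁⟩ := hL e₁ h₁
    (h.subset (singleton_subset_iff.2 (mem_insert _ _))).isNonloop.not_isLoop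
  obtain ⟨⟨u₂, hu₂⟩, hb₂⟩ := hL e₂ h₂
    (h.subset (singleton_subset_iff.2 (mem_insert_of_mem _ rfl))).isNonloop.not_isLoop
  have key : ∀ f g, f ≠ g → f ∉ ({e₁, e₂} : Set α) → g ∉ ({e₁, e₂} : Set α) →
      X.matroid.IsCircuit {e₁, e₂, f, g} → ∃ t, t ≠ u₁ ∧ t ≠ u₂ ∧ u₁ ≠ u₂ ∧
        (Ω.graph.IsLink f u₁ t ∧ Ω.graph.IsLink g t u₂ ∨
          Ω.graph.IsLink g u₁ t ∧ Ω.graph.IsLink f t u₂) := by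
    intro f g hfg hf hg hC
    simp only [mem_insert_iff, mem_singleton_iff, not_or] at hf hg
    exact ((hΩ _).1 hC).exists_path hu₁ hu₂ hb₁ hne hfg hf.1 hf.2 hg.1 hg.2
  -- Links are needed for the second rule, since `{e₁, f, g}` with a loop `f` could be loose
  -- handcuffs. Membership in a circuit `{e₁, e₂, f, g}` guarantees this.
  have nonloop : ∀ f g, f ≠ g → f ∉ ({e₁, e₂} : Set α) → g ∉ ({e₁, e₂} : Set α) →
      X.matroid.IsCircuit {e₁, e₂, f, g} → ∀ x, ¬ Ω.graph.IsLoopAt f x := by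
    intro f g hfg hf hg hC x hx
    obtain ⟨t, h1, h2, -, ⟨h3, -⟩ | ⟨-, h3⟩⟩ := key f g hfg hf hg hC
    · exact h1 ((hx.eq_of_inc h3.inc_right).symm.trans (hx.eq_of_inc h3.inc_left))
    · exact h2 ((hx.eq_of_inc h3.inc_left).symm.trans (hx.eq_of_inc h3.inc_right))
  refine ⟨fun f ↦ Ω.graph.Inc f u₁, ?_, ?_, ?_⟩
  · intro f g hfg hf hg hC
    obtain ⟨t, h1, h2, h3, ⟨h4, h5⟩ | ⟨h4, h5⟩⟩ := key f g hfg hf hg hC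
    · refine iff_of_true h4.inc_left fun h ↦ ?_
      obtain h | h := h.eq_or_eq_of_isLink h5
      exacts [h1 h.symm, h3 h]
    · refine iff_of_false (fun h ↦ ?_) (not_not_intro h4.inc_left)
      obtain h | h := h.eq_or_eq_of_isLink h5
      exacts [h1 h.symm, h3 h]
  · intro f g f' g' hff hgg hf hg hf' hg' hC hC' hD
    exact ((hΩ _).1 hD).inc_of_isLoopAt hu₁ hb₁ (nonloop f f' hff hf hf' hC)
      (nonloop g g' hgg hg hg' hC')
  · intro f g k hfg hfk hgk hf hg hk hC hC' hI
    obtain ⟨t, h1, h2, h3, h4⟩ := key f k hfk hf hk hC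
    obtain ⟨t', h1', h2', h3', h4'⟩ := key g k hgk hg hk hC'
    -- If `k` is not incident with `u₁`, it is the last edge of both paths. Both then have the same
    -- inner vertex `t`, so `f` and `g` are parallel links from `u₁` to `t`.
    by_contra hp
    obtain ⟨h4, h5⟩ | ⟨h4, -⟩ := h4
    swap
    · exact hp h4.inc_left
    obtain ⟨h4', h5'⟩ | ⟨h4', -⟩ := h4'
    swap
    · exact hp h4'.inc_left
    obtain rfl := h5.left_unique h5'
    obtain ⟨C, hCs, hC⟩ := exists_isFrameCircuit_of_parallel hu₁ hb₁ h1.symm hfg h4 h4'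
    exact ((hΩ C).2 hC).not_indep (hI.subset hCs)

end Matroidal

/-! ### Deleting edges from a biased graph. -/

namespace Graph

variable {V α : Type*} {G : Graph V α} {F : Set α}

theorem isCycleSet_deleteEdges {C : Set α} :
    (G.deleteEdges F).IsCycleSet C ↔ G.IsCycleSet C ∧ Disjoint C F := by
  constructor
  · rintro ⟨n, v, e, hv, he, hl, rfl⟩
    simp only [deleteEdges_isLink] at hl
    refine ⟨⟨n, v, e, hv, he, fun i ↦ (hl i).1, rfl⟩, disjoint_left.2 ?_⟩
    rintro _ ⟨i, rfl⟩
    exact (hl i).2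
  · rintro ⟨⟨n, v, e, hv, he, hl, rfl⟩, hF⟩
    refine ⟨n, v, e, hv, he, fun i ↦ ?_, rfl⟩
    rw [deleteEdges_isLink]
    exact ⟨hl i, disjoint_left.1 hF (mem_range_self i)⟩

theorem isPathSet_deleteEdges {x y : V} {P : Set α} :
    (G.deleteEdges F).IsPathSet x y P ↔ G.IsPathSet x y P ∧ Disjoint P F := by
  constructor
  · rintro ⟨n, v, e, hv, h0, h1, hl, rfl⟩
    simp only [deleteEdges_isLink] at hl
    refine ⟨⟨n, v, e, hv, h0, h1, fun i ↦ (hl i).1, rfl⟩, disjoint_left.2 ?_⟩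
    rintro _ ⟨i, rfl⟩
    exact (hl i).2
  · rintro ⟨⟨n, v, e, hv, h0, h1, hl, rfl⟩, hF⟩
    refine ⟨n, v, e, hv, h0, h1, fun i ↦ ?_, rfl⟩
    rw [deleteEdges_isLink]
    exact ⟨hl i, disjoint_left.1 hF (mem_range_self i)⟩

theorem endVerts_deleteEdges {X : Set α} (hX : Disjoint X F) :
    (G.deleteEdges F).endVerts X = G.endVerts X := by
  ext x
  simp only [endVerts, deleteEdges_inc, mem_ofPred_eq]
  exact ⟨fun ⟨e, he, h⟩ ↦ ⟨e, he, h.1⟩, fun ⟨e, he, h⟩ ↦ ⟨e, he, h, disjoint_left.1 hX he⟩⟩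

theorem isTheta_deleteEdges {P Q R : Set α} : (G.deleteEdges F).IsTheta P Q R ↔
    G.IsTheta P Q R ∧ Disjoint P F ∧ Disjoint Q F ∧ Disjoint R F := by
  unfold IsTheta
  simp only [isPathSet_deleteEdges]
  constructor
  · rintro ⟨x, y, hxy, ⟨hP, hPF⟩, ⟨hQ, hQF⟩, ⟨hR, hRF⟩, h⟩
    simp only [endVerts_deleteEdges, hPF, hQF, hRF] at h
    exact ⟨⟨x, y, hxy, hP, hQ, hR, h⟩, hPF, hQF, hRF⟩
  · rintro ⟨⟨x, y, hxy, hP, hQ, hR, h⟩, hPF, hQF, hRF⟩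
    refine ⟨x, y, hxy, ⟨hP, hPF⟩, ⟨hQ, hQF⟩, ⟨hR, hRF⟩, ?_⟩
    simpa only [endVerts_deleteEdges, hPF, hQF, hRF]

end Graph

namespace BiasedGraph

variable {V α : Type*}

/-- The biased graph obtained by deleting the edges in `F`. -/
def deleteEdges (Ω : BiasedGraph V α) (F : Set α) : BiasedGraph V α where
  graph := Ω.graph.deleteEdges F
  balanced := {C | C ∈ Ω.balanced ∧ Disjoint C F}
  isCycleSet_of_balanced C hC :=
    Graph.isCycleSet_deleteEdges.2 ⟨Ω.isCycleSet_of_balanced C hC.1, hC.2⟩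
  theta_property P Q R h h₁ h₂ := by
    rw [Graph.isTheta_deleteEdges] at h
    exact ⟨Ω.theta_property P Q R h.1 h₁.1 h₂.1, disjoint_union_left.2 ⟨h.2.1, h.2.2.2⟩⟩

variable {Ω : BiasedGraph V α} {F : Set α}

theorem mem_balanced_deleteEdges {C : Set α} (hC : Disjoint C F) :
    C ∈ (Ω.deleteEdges F).balanced ↔ C ∈ Ω.balanced :=
  and_iff_left hC

theorem isUnbalancedCycle_deleteEdges {C : Set α} :
    (Ω.deleteEdges F).IsUnbalancedCycle C ↔ Ω.IsUnbalancedCycle C ∧ Disjoint C F := by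
  simp only [IsUnbalancedCycle, deleteEdges, Graph.isCycleSet_deleteEdges, mem_ofPred_eq]
  tauto

theorem isTightHandcuff_deleteEdges {X : Set α} :
    (Ω.deleteEdges F).IsTightHandcuff X ↔ Ω.IsTightHandcuff X ∧ Disjoint X F := by
  constructor
  · rintro ⟨C, D, hC, hD, h, ⟨x, hx⟩, rfl⟩
    rw [isUnbalancedCycle_deleteEdges] at hC hD
    simp only [deleteEdges, Graph.endVerts_deleteEdges, hC.2, hD.2] at hx
    exact ⟨⟨C, D, hC.1, hD.1, h, ⟨x, hx⟩, rfl⟩, disjoint_union_left.2 ⟨hC.2, hD.2⟩⟩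
  · rintro ⟨⟨C, D, hC, hD, h, ⟨x, hx⟩, rfl⟩, hF⟩
    obtain ⟨hCF, hDF⟩ := disjoint_union_left.1 hF
    refine ⟨C, D, isUnbalancedCycle_deleteEdges.2 ⟨hC, hCF⟩,
      isUnbalancedCycle_deleteEdges.2 ⟨hD, hDF⟩, h, ⟨x, ?_⟩, rfl⟩
    simpa only [deleteEdges, Graph.endVerts_deleteEdges, hCF, hDF]

theorem isLooseHandcuff_deleteEdges {X : Set α} :
    (Ω.deleteEdges F).IsLooseHandcuff X ↔ Ω.IsLooseHandcuff X ∧ Disjoint X F := by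
  constructor
  · rintro ⟨C, D, P, x, y, hC, hD, h, hP, hx, hy, rfl⟩
    rw [isUnbalancedCycle_deleteEdges] at hC hD
    simp only [deleteEdges, Graph.isPathSet_deleteEdges] at hP
    simp only [deleteEdges, Graph.endVerts_deleteEdges, hC.2, hD.2, hP.2] at h hx hy
    exact ⟨⟨C, D, P, x, y, hC.1, hD.1, h, hP.1, hx, hy, rfl⟩,
      disjoint_union_left.2 ⟨disjoint_union_left.2 ⟨hC.2, hP.2⟩, hD.2⟩⟩
  · rintro ⟨⟨C, D, P, x, y, hC, hD, h, hP, hx, hy, rfl⟩, hF⟩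
    obtain ⟨hCPF, hDF⟩ := disjoint_union_left.1 hF
    obtain ⟨hCF, hPF⟩ := disjoint_union_left.1 hCPF
    refine ⟨C, D, P, x, y, isUnbalancedCycle_deleteEdges.2 ⟨hC, hCF⟩,
      isUnbalancedCycle_deleteEdges.2 ⟨hD, hDF⟩, ?_, Graph.isPathSet_deleteEdges.2 ⟨hP, hPF⟩,
      ?_, ?_, rfl⟩ <;>
    simpa only [deleteEdges, Graph.endVerts_deleteEdges, hCF, hDF, hPF]

theorem isUnbalancedTheta_deleteEdges {X : Set α} :
    (Ω.deleteEdges F).IsUnbalancedTheta X ↔ Ω.IsUnbalancedTheta X ∧ Disjoint X F := by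
  constructor
  · rintro ⟨P, Q, R, h, h1, h2, h3, rfl⟩
    obtain ⟨h, hP, hQ, hR⟩ := Graph.isTheta_deleteEdges.1 h
    rw [mem_balanced_deleteEdges (disjoint_union_left.2 ⟨‹_›, ‹_›⟩)] at h1 h2 h3
    exact ⟨⟨P, Q, R, h, h1, h2, h3, rfl⟩,
      disjoint_union_left.2 ⟨disjoint_union_left.2 ⟨hP, hQ⟩, hR⟩⟩
  · rintro ⟨⟨P, Q, R, h, h1, h2, h3, rfl⟩, hF⟩
    obtain ⟨hPQ, hR⟩ := disjoint_union_left.1 hF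
    obtain ⟨hP, hQ⟩ := disjoint_union_left.1 hPQ
    refine ⟨P, Q, R, Graph.isTheta_deleteEdges.2 ⟨h, hP, hQ, hR⟩, ?_, ?_, ?_, rfl⟩ <;>
    rwa [mem_balanced_deleteEdges (disjoint_union_left.2 ⟨‹_›, ‹_›⟩)]

/-- Cycles, paths, their end vertices and balance are unaffected by deletion as long as the edge
sets concerned avoid `F`, so each of the four kinds of circuit restricts. -/
theorem isFrameCircuit_deleteEdges {X : Set α} :
    (Ω.deleteEdges F).IsFrameCircuit X ↔ Ω.IsFrameCircuit X ∧ Disjoint X F := by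
  unfold IsFrameCircuit
  rw [isTightHandcuff_deleteEdges, isLooseHandcuff_deleteEdges, isUnbalancedTheta_deleteEdges]
  simp only [deleteEdges, mem_ofPred_eq]
  tauto

theorem Represents.delete {M : Matroid α} (h : Ω.Represents M) (F : Set α) :
    (Ω.deleteEdges F).Represents (M.delete F) := by
  refine ⟨?_, fun X ↦ ?_⟩
  · rw [Matroid.delete_ground, h.1]
    rfl
  · rw [Matroid.delete_isCircuit_iff, isFrameCircuit_deleteEdges, h.2]

end BiasedGraph

namespace Matroidal

variable {α : Type*}

/-- Deleting elements outside `L` preserves frame matroidals. -/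
theorem IsFrame.of_delete {X Y : Matroidal α} (hX : X.IsFrame) {F : Set α}
    (hM : Y.matroid = X.matroid.delete F) (hL : Y.L = X.L) : Y.IsFrame := by
  obtain ⟨V, Ω, hV, hΩ, h⟩ := hX
  refine ⟨V, Ω.deleteEdges F, hV, hM ▸ hΩ.delete F, fun e he hl ↦ ?_⟩
  have heF : e ∉ F := by
    have := Y.L_subset he
    rw [hM, Matroid.delete_ground] at this
    exact this.2
  rw [hM, Matroid.delete_isLoop_iff, and_iff_left heF] at hl
  obtain ⟨⟨x, hx⟩, hb⟩ := h e (hL ▸ he) hl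
  exact ⟨⟨x, Graph.deleteEdges_isLoopAt.2 ⟨hx, heF⟩⟩, fun h ↦ hb h.1⟩

theorem IsFrame.mono {X Y : Matroidal α} (hX : X.IsFrame) (hM : Y.matroid = X.matroid)
    (hL : Y.L ⊆ X.L) : Y.IsFrame := by
  obtain ⟨V, Ω, hV, hΩ, h⟩ := hX
  exact ⟨V, Ω, hV, hM ▸ hΩ, fun e he hl ↦ h e (hL he) (hM ▸ hl)⟩

end Matroidal

/-! ### Matroids of rank at most two as frame matroids on two vertices. -/

namespace Graph

variable {α : Type*} {G : Graph (Fin 2) α}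

theorem isLink_zero_one {e : α} {x y : Fin 2} (hxy : x ≠ y) (h : G.IsLink e x y) :
    G.IsLink e 0 1 := by
  fin_cases x <;> fin_cases y
  exacts [(hxy rfl).elim, h, h.symm, (hxy rfl).elim]

theorem endVerts_of_isLink_zero_one {e : α} {X : Set α} (he : e ∈ X) (h : G.IsLink e 0 1) :
    G.endVerts X = univ := by
  refine eq_univ_of_forall fun x ↦ ⟨e, he, ?_⟩
  fin_cases x
  exacts [h.inc_left, h.inc_right]

theorem IsCycleSet.cases_fin_two {C : Set α} (hC : G.IsCycleSet C) :
    (∃ e x, G.IsLoopAt e x ∧ C = {e}) ∨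
    (∃ e f, e ≠ f ∧ G.IsLink e 0 1 ∧ G.IsLink f 0 1 ∧ C = {e, f}) := by
  obtain h | ⟨e, f, x, y, hef, hxy, he, hf, rfl⟩ | ⟨n, v, e, hv, -, -, -⟩ := hC.cases
  · exact .inl h
  · exact .inr ⟨e, f, hef, isLink_zero_one hxy he, isLink_zero_one hxy hf, rfl⟩
  · have := Fintype.card_le_of_injective v hv
    simp at this

theorem IsPathSet.of_ne_fin_two {x y : Fin 2} {P : Set α} (hP : G.IsPathSet x y P) (hxy : x ≠ y) :
    ∃ e, G.IsLink e 0 1 ∧ P = {e} := by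
  obtain ⟨h, -⟩ | ⟨-, e, he, rfl⟩ | ⟨z, e, f, h1, h2, h3, -⟩ | ⟨n, v, e, hv, -⟩ := hP.cases
  · exact (hxy h).elim
  · exact ⟨e, isLink_zero_one hxy he, rfl⟩
  · omega
  · have := Fintype.card_le_of_injective v hv
    simp at this

theorem IsTheta.cases_fin_two {P Q R : Set α} (h : G.IsTheta P Q R) :
    ∃ e f g, e ≠ f ∧ f ≠ g ∧ e ≠ g ∧ G.IsLink e 0 1 ∧ G.IsLink f 0 1 ∧ G.IsLink g 0 1 ∧
      P = {e} ∧ Q = {f} ∧ R = {g} := by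
  obtain ⟨x, y, hxy, hP, hQ, hR, hPQ, hQR, hPR, -⟩ := h
  obtain ⟨e, he, rfl⟩ := hP.of_ne_fin_two hxy
  obtain ⟨f, hf, rfl⟩ := hQ.of_ne_fin_two hxy
  obtain ⟨g, hg, rfl⟩ := hR.of_ne_fin_two hxy
  rw [disjoint_singleton] at hPQ hQR hPR
  exact ⟨e, f, g, hPQ, hQR, hPR, he, hf, hg, rfl, rfl, rfl⟩

theorem isTheta_zero_one {e f g : α} (hef : e ≠ f) (hfg : f ≠ g) (heg : e ≠ g)
    (he : G.IsLink e 0 1) (hf : G.IsLink f 0 1) (hg : G.IsLink g 0 1) :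
    G.IsTheta {e} {f} {g} := by
  refine ⟨0, 1, by decide, isPathSet_singleton (by decide) he, isPathSet_singleton (by decide) hf,
    isPathSet_singleton (by decide) hg, disjoint_singleton.2 hef, disjoint_singleton.2 hfg,
    disjoint_singleton.2 heg, ?_, ?_, ?_⟩ <;>
  simp [endVerts_singleton he, endVerts_singleton hf, endVerts_singleton hg]

end Graph

namespace Matroid

variable {α : Type*} {M : Matroid α}

theorem pair_indep_of_closure_ne {e f : α} (he : M.IsNonloop e) (hf : M.IsNonloop f)
    (h : M.closure {e} ≠ M.closure {f}) : M.Indep {e, f} := by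
  by_contra hi
  refine h ((he.closure_eq_closure_iff_eq_or_dep hf).2 (.inr hi))

/-- The circuits of a matroid of rank at most two are the loops, the pairs of parallel elements and
the triples of pairwise non-parallel elements. -/
theorem isCircuit_iff_of_eRank_le_two (hM : M.eRank ≤ 2) {X : Set α} : M.IsCircuit X ↔
    (∃ e, M.IsLoop e ∧ X = {e}) ∨
    (∃ e f, e ≠ f ∧ M.IsNonloop e ∧ M.IsNonloop f ∧ M.closure {e} = M.closure {f} ∧ X = {e, f}) ∨
    ∃ e f g, M.IsNonloop e ∧ M.IsNonloop f ∧ M.IsNonloop g ∧ M.closure {e} ≠ M.closure {f} ∧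
      M.closure {f} ≠ M.closure {g} ∧ M.closure {e} ≠ M.closure {g} ∧ X = {e, f, g} := by
  constructor
  · intro hX
    -- A circuit has one element more than its rank.
    have h3 : X.encard ≤ 3 := by
      rw [← hX.eRk_add_one_eq]
      exact add_le_add_left ((M.eRk_le_eRank X).trans hM) 1
    obtain ⟨n, hn⟩ : ∃ n : ℕ, X.encard = n := (ENat.ne_top_iff_exists.1
      (ne_top_of_le_ne_top (by decide) h3)).imp fun _ h ↦ h.symm
    have hn3 : n ≤ 3 := by rw [hn] at h3; exact_mod_cast h3
    interval_cases n
    · have := hX.nonempty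
      simp_all
    · obtain ⟨e, rfl⟩ := encard_eq_one.1 (by simpa using hn)
      exact .inl ⟨e, singleton_isCircuit.1 hX, rfl⟩
    · obtain ⟨e, f, hef, rfl⟩ := encard_eq_two.1 (by simpa using hn)
      have hnt : ({e, f} : Set α).Nontrivial := nontrivial_pair hef
      have he := hX.isNonloop_of_mem hnt (mem_insert _ _)
      have hf := hX.isNonloop_of_mem hnt (mem_insert_of_mem _ rfl)
      exact .inr (.inl ⟨e, f, hef, he, hf,
        (he.closure_eq_closure_iff_isCircuit_of_ne hef).2 hX, rfl⟩)
    · obtain ⟨e, f, g, hef, heg, hfg, rfl⟩ := encard_eq_three.1 (by simpa using hn)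
      have hnt : ({e, f, g} : Set α).Nontrivial := ⟨e, by simp, f, by simp, hef⟩
      -- Two parallel elements of a three-element circuit would form a circuit properly contained in
      -- it.
      have key : ∀ s t u, s ≠ t → t ≠ u → s ≠ u → M.IsCircuit {s, t, u} → M.IsNonloop s →
          M.closure {s} ≠ M.closure {t} := by
        intro s t u hst htu hsu hC hs h
        have hC' := (hs.closure_eq_closure_iff_isCircuit_of_ne hst).1 h
        have h := hC'.eq_of_subset_isCircuit hC (by grind)
        have : u ∈ ({s, t} : Set α) := h ▸ (by simp)
        grind
      have he := hX.isNonloop_of_mem hnt (show e ∈ _ by simp)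
      have hf := hX.isNonloop_of_mem hnt (show f ∈ _ by simp)
      have hg := hX.isNonloop_of_mem hnt (show g ∈ _ by simp)
      refine .inr (.inr ⟨e, f, g, he, hf, hg, key e f g hef hfg heg hX he,
        key f g e hfg heg.symm hef.symm ?_ hf, key e g f heg hfg.symm hef ?_ he, rfl⟩)
      · convert hX using 1
        grind
      · convert hX using 1
        grind
  · rintro (⟨e, he, rfl⟩ | ⟨e, f, hef, he, hf, h, rfl⟩ | ⟨e, f, g, he, hf, hg, h1, h2, h3, rfl⟩)
    · exact singleton_isCircuit.2 he
    · exact (he.closure_eq_closure_iff_isCircuit_of_ne hef).1 h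
    · rw [isCircuit_iff_dep_forall_sdiff_singleton_indep]
      have hef : e ≠ f := by rintro rfl; exact h1 rfl
      have hfg : f ≠ g := by rintro rfl; exact h2 rfl
      have heg : e ≠ g := by rintro rfl; exact h3 rfl
      refine ⟨⟨fun hi ↦ ?_, ?_⟩, ?_⟩
      · have h := hi.encard_le_eRank.trans hM
        rw [encard_eq_three.2 ⟨e, f, g, hef, heg, hfg, rfl⟩] at h
        exact absurd h (by decide)
      · simp [insert_subset_iff, he.mem_ground, hf.mem_ground, hg.mem_ground]
      · rintro t (rfl | rfl | rfl)
        · exact (pair_indep_of_closure_ne hf hg h2).subset (by grind)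
        · exact (pair_indep_of_closure_ne he hg h3).subset (by grind)
        · exact (pair_indep_of_closure_ne he hf h1).subset (by grind)

open Classical in
/-- The graph on two vertices in which the elements parallel to `p` are loops at the first vertex,
the other elements parallel to `q` are loops at the second vertex, and the other nonloops of `M` are
links; loops of `M` are loops at the first vertex. -/
noncomputable def twoVertexGraph (M : Matroid α) (p q : α) : Graph (Fin 2) α :=
  Graph.ofEnds M.E fun e ↦
    if ¬ M.IsNonloop e ∨ M.closure {e} = M.closure {p} then s(0, 0)
    else if M.closure {e} = M.closure {q} then s(1, 1) else s(0, 1)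

variable {p q e : α}

theorem isLoopAt_zero_twoVertexGraph : (M.twoVertexGraph p q).IsLoopAt e 0 ↔
    M.IsLoop e ∨ M.IsNonloop e ∧ M.closure {e} = M.closure {p} := by
  have h1 : M.IsLoop e → e ∈ M.E := fun h ↦ h.mem_ground
  have h2 : M.IsNonloop e → e ∈ M.E := fun h ↦ h.mem_ground
  have h3 : e ∈ M.E → (¬ M.IsNonloop e ↔ M.IsLoop e) := fun h ↦ not_isNonloop_iff
  simp only [twoVertexGraph, Graph.ofEnds, Graph.IsLoopAt]
  split_ifs <;> simp <;> tauto

theorem isLoopAt_one_twoVertexGraph : (M.twoVertexGraph p q).IsLoopAt e 1 ↔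
    M.IsNonloop e ∧ M.closure {e} ≠ M.closure {p} ∧ M.closure {e} = M.closure {q} := by
  have h2 : M.IsNonloop e → e ∈ M.E := fun h ↦ h.mem_ground
  simp only [twoVertexGraph, Graph.ofEnds, Graph.IsLoopAt]
  split_ifs <;> simp <;> tauto

theorem isLink_twoVertexGraph : (M.twoVertexGraph p q).IsLink e 0 1 ↔
    M.IsNonloop e ∧ M.closure {e} ≠ M.closure {p} ∧ M.closure {e} ≠ M.closure {q} := by
  have h2 : M.IsNonloop e → e ∈ M.E := fun h ↦ h.mem_ground
  simp only [twoVertexGraph, Graph.ofEnds]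
  split_ifs <;> simp <;> tauto

/-- The biased graph on `M.twoVertexGraph p q` in which a cycle is balanced if it is a circuit of
`M`. -/
noncomputable def twoVertexBiasedGraph (M : Matroid α) (p q : α) : BiasedGraph (Fin 2) α where
  graph := M.twoVertexGraph p q
  balanced := {C | (M.twoVertexGraph p q).IsCycleSet C ∧ M.IsCircuit C}
  isCycleSet_of_balanced _ h := h.1
  theta_property P Q R h h₁ h₂ := by
    -- On two vertices a theta consists of three parallel links, and a cycle of two links is
    -- balanced exactly when they are parallel in `M`. The theta property is therefore transitivity
    -- of parallelism.
    obtain ⟨e, f, g, hef, hfg, heg, he, hf, hg, rfl, rfl, rfl⟩ := h.cases_fin_two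
    have he' := (isLink_twoVertexGraph.1 he).1
    have hf' := (isLink_twoVertexGraph.1 hf).1
    rw [singleton_union] at h₁ h₂ ⊢
    refine ⟨Graph.isCycleSet_pair heg (by decide) he hg, ?_⟩
    rw [← he'.closure_eq_closure_iff_isCircuit_of_ne heg]
    exact ((he'.closure_eq_closure_iff_isCircuit_of_ne hef).2 h₁.2).trans
      ((hf'.closure_eq_closure_iff_isCircuit_of_ne hfg).2 h₂.2)

theorem isUnbalancedCycle_singleton {x : Fin 2} (he : (M.twoVertexGraph p q).IsLoopAt e x)
    (h : M.IsNonloop e) : (M.twoVertexBiasedGraph p q).IsUnbalancedCycle {e} :=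
  ⟨Graph.isCycleSet_singleton he, fun hC ↦ h.not_isLoop (singleton_isCircuit.1 hC.2)⟩

theorem isUnbalancedCycle_pair {f : α} (he : (M.twoVertexGraph p q).IsLink e 0 1)
    (hf : (M.twoVertexGraph p q).IsLink f 0 1) (h : M.closure {e} ≠ M.closure {f}) :
    (M.twoVertexBiasedGraph p q).IsUnbalancedCycle {e, f} := by
  have hef : e ≠ f := by rintro rfl; exact h rfl
  refine ⟨Graph.isCycleSet_pair hef (by decide) he hf, fun hC ↦ h ?_⟩
  exact ((isLink_twoVertexGraph.1 he).1.closure_eq_closure_iff_isCircuit_of_ne hef).2 hC.2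

theorem unbalancedCycle_cases {C : Set α} (hC : (M.twoVertexBiasedGraph p q).IsUnbalancedCycle C) :
    (∃ e x, (M.twoVertexGraph p q).IsLoopAt e x ∧ M.IsNonloop e ∧
      (x = 0 ∧ M.closure {e} = M.closure {p} ∨
        x = 1 ∧ M.closure {e} ≠ M.closure {p} ∧ M.closure {e} = M.closure {q}) ∧ C = {e}) ∨
    (∃ e f, (M.twoVertexGraph p q).IsLink e 0 1 ∧ (M.twoVertexGraph p q).IsLink f 0 1 ∧
      M.closure {e} ≠ M.closure {f} ∧ C = {e, f}) := by
  obtain ⟨h, hb⟩ := hC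
  obtain ⟨e, x, he, rfl⟩ | ⟨e, f, hef, he, hf, rfl⟩ := h.cases_fin_two
  · have hl : ¬ M.IsLoop e := fun hl ↦ hb ⟨h, singleton_isCircuit.2 hl⟩
    refine .inl ⟨e, x, he, ?_⟩
    obtain rfl | rfl : x = 0 ∨ x = 1 := by omega
    · obtain ⟨h1, h2⟩ := (isLoopAt_zero_twoVertexGraph.1 he).resolve_left hl
      exact ⟨h1, .inl ⟨rfl, h2⟩, rfl⟩
    · obtain ⟨h1, h2⟩ := isLoopAt_one_twoVertexGraph.1 he
      exact ⟨h1, .inr ⟨rfl, h2⟩, rfl⟩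
  · refine .inr ⟨e, f, he, hf, fun hcl ↦ hb ⟨h, ?_⟩, rfl⟩
    exact ((isLink_twoVertexGraph.1 he).1.closure_eq_closure_iff_isCircuit_of_ne hef).1 hcl

theorem isFrameCircuit_two_loops {f : α} {x : Fin 2} (hef : e ≠ f)
    (he : (M.twoVertexGraph p q).IsLoopAt e x) (hf : (M.twoVertexGraph p q).IsLoopAt f x)
    (he' : M.IsNonloop e) (hf' : M.IsNonloop f) :
    (M.twoVertexBiasedGraph p q).IsFrameCircuit {e, f} := by
  refine .inr (.inl ⟨{e}, {f}, isUnbalancedCycle_singleton he he',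
    isUnbalancedCycle_singleton hf hf', disjoint_singleton.2 hef, ⟨x, ?_⟩, rfl⟩)
  change (M.twoVertexGraph p q).endVerts {e} ∩ (M.twoVertexGraph p q).endVerts {f} = {x}
  rw [he.endVerts_eq, hf.endVerts_eq, inter_self]

theorem isFrameCircuit_loop_pair {f g : α} {x : Fin 2}
    (he : (M.twoVertexGraph p q).IsLoopAt e x) (he' : M.IsNonloop e)
    (hf : (M.twoVertexGraph p q).IsLink f 0 1) (hg : (M.twoVertexGraph p q).IsLink g 0 1)
    (hef : e ≠ f) (heg : e ≠ g) (h : M.closure {f} ≠ M.closure {g}) :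
    (M.twoVertexBiasedGraph p q).IsFrameCircuit {e, f, g} := by
  refine .inr (.inl ⟨{e}, {f, g}, isUnbalancedCycle_singleton he he',
    isUnbalancedCycle_pair hf hg h, by simp [hef, heg], ⟨x, ?_⟩, rfl⟩)
  change (M.twoVertexGraph p q).endVerts {e} ∩ (M.twoVertexGraph p q).endVerts {f, g} = {x}
  rw [he.endVerts_eq, Graph.endVerts_of_isLink_zero_one (mem_insert _ _) hf, inter_univ]

theorem isFrameCircuit_loop_link_loop {f g : α}
    (he : (M.twoVertexGraph p q).IsLoopAt e 0) (he' : M.IsNonloop e)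
    (hf : (M.twoVertexGraph p q).IsLoopAt f 1) (hf' : M.IsNonloop f)
    (hg : (M.twoVertexGraph p q).IsLink g 0 1) :
    (M.twoVertexBiasedGraph p q).IsFrameCircuit {e, f, g} := by
  refine .inr (.inr (.inl ⟨{e}, {f}, {g}, 0, 1, isUnbalancedCycle_singleton he he',
    isUnbalancedCycle_singleton hf hf', ?_, Graph.isPathSet_singleton (by decide) hg, ?_, ?_, ?_⟩))
  · change Disjoint ((M.twoVertexGraph p q).endVerts {e}) ((M.twoVertexGraph p q).endVerts {f})
    simp [he.endVerts_eq, hf.endVerts_eq]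
  · change (M.twoVertexGraph p q).endVerts {g} ∩ (M.twoVertexGraph p q).endVerts {e} = _
    rw [he.endVerts_eq, Graph.endVerts_of_isLink_zero_one (mem_singleton g) hg, univ_inter]
  · change (M.twoVertexGraph p q).endVerts {g} ∩ (M.twoVertexGraph p q).endVerts {f} = _
    rw [hf.endVerts_eq, Graph.endVerts_of_isLink_zero_one (mem_singleton g) hg, univ_inter]
  · grind

/-- Every matroid of rank at most two is the frame matroid of a biased graph on two vertices. -/
theorem represents_twoVertexBiasedGraph (hM : M.eRank ≤ 2) (p q : α) :
    (M.twoVertexBiasedGraph p q).Represents M := by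
  refine ⟨rfl, fun X ↦ ?_⟩
  have hc := isCircuit_iff_of_eRank_le_two hM (X := X)
  constructor
  -- The position of a nonloop depends only on its parallel class. Two loops at the same vertex are
  -- always parallel, while links may or may not be.
  · have type : ∀ e, M.IsNonloop e →
        (M.twoVertexGraph p q).IsLoopAt e 0 ∧ M.closure {e} = M.closure {p} ∨
        (M.twoVertexGraph p q).IsLoopAt e 1 ∧ M.closure {e} = M.closure {q} ∨
        (M.twoVertexGraph p q).IsLink e 0 1 := by
      intro e he
      rw [isLoopAt_zero_twoVertexGraph, isLoopAt_one_twoVertexGraph, isLink_twoVertexGraph]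
      tauto
    intro hX
    obtain ⟨e, he, rfl⟩ | ⟨e, f, hef, he, hf, h, rfl⟩ | ⟨e, f, g, he, hf, hg, h1, h2, h3, rfl⟩ :=
      hc.1 hX
    · exact .inl ⟨Graph.isCycleSet_singleton (isLoopAt_zero_twoVertexGraph.2 (.inl he)), hX⟩
    · obtain ⟨h1, h2⟩ | ⟨h1, h2⟩ | h1 := type e he
      · exact isFrameCircuit_two_loops hef h1
          (isLoopAt_zero_twoVertexGraph.2 (.inr ⟨hf, h ▸ h2⟩)) he hf
      · refine isFrameCircuit_two_loops hef h1 ?_ he hf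
        rw [isLoopAt_one_twoVertexGraph] at h1 ⊢
        exact ⟨hf, h ▸ h1.2⟩
      · refine .inl ⟨Graph.isCycleSet_pair hef (by decide) h1 ?_, hX⟩
        rw [isLink_twoVertexGraph] at h1 ⊢
        exact ⟨hf, h ▸ h1.2⟩
    · have hef : e ≠ f := by rintro rfl; exact h1 rfl
      have hfg : f ≠ g := by rintro rfl; exact h2 rfl
      have heg : e ≠ g := by rintro rfl; exact h3 rfl
      have r1 : ({e, f, g} : Set α) = {f, e, g} := insert_comm _ _ _
      have r2 : ({e, f, g} : Set α) = {g, e, f} := by rw [pair_comm f g, insert_comm]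
      have r3 : ({e, f, g} : Set α) = {e, g, f} := by rw [pair_comm f g]
      have r4 : ({e, f, g} : Set α) = {f, g, e} := by rw [r1, pair_comm]
      have r5 : ({e, f, g} : Set α) = {g, f, e} := by rw [r2, pair_comm]
      -- Three pairwise non-parallel elements include at most one loop at each vertex. With two
      -- loops they are loose handcuffs, with one loop tight handcuffs, and with none an unbalanced
      -- theta; `r1` to `r5` rearrange the triple.
      obtain ⟨e1, e2⟩ | ⟨e1, e2⟩ | e1 := type e he <;>
      obtain ⟨f1, f2⟩ | ⟨f1, f2⟩ | f1 := type f hf <;>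
      obtain ⟨g1, g2⟩ | ⟨g1, g2⟩ | g1 := type g hg <;>
      first
      | exact (h1 (e2.trans f2.symm)).elim
      | exact (h2 (f2.trans g2.symm)).elim
      | exact (h3 (e2.trans g2.symm)).elim
      | exact isFrameCircuit_loop_link_loop e1 he f1 hf g1
      | exact r1 ▸ isFrameCircuit_loop_link_loop f1 hf e1 he g1
      | exact r2 ▸ isFrameCircuit_loop_link_loop g1 hg e1 he f1
      | exact r3 ▸ isFrameCircuit_loop_link_loop e1 he g1 hg f1
      | exact r4 ▸ isFrameCircuit_loop_link_loop f1 hf g1 hg e1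
      | exact r5 ▸ isFrameCircuit_loop_link_loop g1 hg f1 hf e1
      | exact isFrameCircuit_loop_pair e1 he f1 g1 hef heg h2
      | exact r1 ▸ isFrameCircuit_loop_pair f1 hf e1 g1 hef.symm hfg h3
      | exact r2 ▸ isFrameCircuit_loop_pair g1 hg e1 f1 heg.symm hfg.symm h1
      | exact .inr (.inr (.inr ⟨{e}, {f}, {g}, Graph.isTheta_zero_one hef hfg heg e1 f1 g1,
          (isUnbalancedCycle_pair e1 f1 h1).2, (isUnbalancedCycle_pair f1 g1 h2).2,
          (isUnbalancedCycle_pair e1 g1 h3).2, by rw [union_assoc]; rfl⟩))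
  · rintro (h | ⟨C, D, hC, hD, hCD, ⟨z, hz⟩, rfl⟩ | ⟨C, D, P, x, y, hC, hD, hCD, hP, hx, hy, rfl⟩ |
      ⟨P, Q, R, h, h1, h2, h3, rfl⟩)
    · exact h.2
    · change (M.twoVertexGraph p q).endVerts C ∩ (M.twoVertexGraph p q).endVerts D = {z} at hz
      obtain ⟨e, x, he, he', hex, rfl⟩ | ⟨e, f, he, hf, hef, rfl⟩ := unbalancedCycle_cases hC <;>
      obtain ⟨g, y, hg, hg', hgy, rfl⟩ | ⟨g, h, hg, hh, hgh, rfl⟩ := unbalancedCycle_cases hD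
      · rw [he.endVerts_eq, hg.endVerts_eq] at hz
        have hxy : x = y := by
          have : z ∈ ({x} ∩ {y} : Set (Fin 2)) := hz ▸ rfl
          exact this.1.symm.trans this.2
        refine hc.2 (.inr (.inl ⟨e, g, disjoint_singleton.1 hCD, he', hg', ?_, rfl⟩))
        grind
      · rw [isLink_twoVertexGraph] at hg hh
        exact hc.2 (.inr (.inr ⟨e, g, h, he', hg.1, hh.1, by grind, hgh, by grind, rfl⟩))
      · rw [isLink_twoVertexGraph] at he hf
        exact hc.2 (.inr (.inr ⟨g, e, f, hg', he.1, hf.1, by grind, hef, by grind,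
          union_comm _ _⟩))
      -- Two cycles of links share both vertices, so they cannot be tight handcuffs.
      · rw [Graph.endVerts_of_isLink_zero_one (mem_insert _ _) he,
          Graph.endVerts_of_isLink_zero_one (mem_insert _ _) hg, inter_univ] at hz
        have h0 : (0 : Fin 2) ∈ ({z} : Set (Fin 2)) := hz ▸ mem_univ _
        have h1 : (1 : Fin 2) ∈ ({z} : Set (Fin 2)) := hz ▸ mem_univ _
        exact absurd (h0.trans h1.symm) (by decide)
    · change Disjoint ((M.twoVertexGraph p q).endVerts C) ((M.twoVertexGraph p q).endVerts D) at hCD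
      change (M.twoVertexGraph p q).IsPathSet x y P at hP
      change (M.twoVertexGraph p q).endVerts P ∩ (M.twoVertexGraph p q).endVerts C = {x} at hx
      change (M.twoVertexGraph p q).endVerts P ∩ (M.twoVertexGraph p q).endVerts D = {y} at hy
      have hxC : x ∈ (M.twoVertexGraph p q).endVerts C := (hx.ge rfl).2
      have hyD : y ∈ (M.twoVertexGraph p q).endVerts D := (hy.ge rfl).2
      obtain ⟨e, s, he, he', hes, rfl⟩ | ⟨e, f, he, hf, hef, rfl⟩ := unbalancedCycle_cases hC
      -- A cycle of links covers both vertices and is vertex-disjoint from no other cycle, so both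
      -- cycles of loose handcuffs are loops.
      swap
      · rw [Graph.endVerts_of_isLink_zero_one (mem_insert _ _) he, univ_disjoint] at hCD
        exact (hCD ▸ hyD : y ∈ (∅ : Set (Fin 2))).elim
      obtain ⟨g, t, hg, hg', hgt, rfl⟩ | ⟨g, h, hg, hh, hgh, rfl⟩ := unbalancedCycle_cases hD
      swap
      · rw [Graph.endVerts_of_isLink_zero_one (mem_insert _ _) hg, disjoint_univ] at hCD
        exact (hCD ▸ hxC : x ∈ (∅ : Set (Fin 2))).elim
      rw [he.endVerts_eq] at hxC hCD
      rw [hg.endVerts_eq] at hyD hCD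
      obtain rfl : x = s := hxC
      obtain rfl : y = t := hyD
      rw [disjoint_singleton] at hCD
      obtain ⟨h, hh, rfl⟩ := hP.of_ne_fin_two hCD
      rw [isLink_twoVertexGraph] at hh
      refine hc.2 (.inr (.inr ⟨e, h, g, he', hh.1, hg', by grind, by grind, by grind, ?_⟩))
      rw [union_assoc]
      rfl
    · obtain ⟨e, f, g, hef, hfg, heg, he, hf, hg, rfl, rfl, rfl⟩ := Graph.IsTheta.cases_fin_two h
      have he' := (isLink_twoVertexGraph.1 he).1
      have hf' := (isLink_twoVertexGraph.1 hf).1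
      refine hc.2 (.inr (.inr ⟨e, f, g, he', hf', (isLink_twoVertexGraph.1 hg).1,
        fun hcl ↦ h1 ⟨Graph.isCycleSet_pair hef (by decide) he hf, ?_⟩,
        fun hcl ↦ h2 ⟨Graph.isCycleSet_pair hfg (by decide) hf hg, ?_⟩,
        fun hcl ↦ h3 ⟨Graph.isCycleSet_pair heg (by decide) he hg, ?_⟩, by rw [union_assoc]; rfl⟩))
      · exact (he'.closure_eq_closure_iff_isCircuit_of_ne hef).1 hcl
      · exact (hf'.closure_eq_closure_iff_isCircuit_of_ne hfg).1 hcl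
      · exact (he'.closure_eq_closure_iff_isCircuit_of_ne heg).1 hcl

end Matroid

namespace Matroidal

/-- A matroidal of rank at most two with at most two distinguished elements is frame. -/
theorem isFrame_of_eRank_le_two {α : Type*} {X : Matroidal α} (hX : X.matroid.eRank ≤ 2) {p q : α}
    (hL : X.L ⊆ {p, q}) : X.IsFrame := by
  refine ⟨Fin 2, X.matroid.twoVertexBiasedGraph p q, Set.toFinite _,
    Matroid.represents_twoVertexBiasedGraph hX p q, fun e he hl ↦ ?_⟩
  have he' : X.matroid.IsNonloop e := Matroid.isNonloop_of_not_isLoop (X.L_subset he) hl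
  have hex : ∃ x, (X.matroid.twoVertexGraph p q).IsLoopAt e x := by
    -- When `p` and `q` are parallel, both are loops at the first vertex; otherwise `q` is a loop at
    -- the second.
    by_cases h : X.matroid.closure {e} = X.matroid.closure {p}
    · exact ⟨0, Matroid.isLoopAt_zero_twoVertexGraph.2 (.inr ⟨he', h⟩)⟩
    · refine ⟨1, Matroid.isLoopAt_one_twoVertexGraph.2 ⟨he', h, ?_⟩⟩
      obtain rfl | rfl := hL he
      exacts [(h rfl).elim, rfl]
  obtain ⟨x, hx⟩ := hex
  exact ⟨⟨x, hx⟩, (Matroid.isUnbalancedCycle_singleton hx he').2⟩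

end Matroidal

/-! ### Matroids of rank at most three given by their three-element lines. -/

namespace Matroid

variable {α : Type*}

/-- The matroid of rank at most three on `E` in which the sets in `T` are the three-element
lines: a set is independent if it has at most three elements and is not in `T`. Two distinct members
of `T` have at most one common element. -/
def ofLines (E : Set α) (T : Set (Set α)) (hT : ∀ t ∈ T, t.encard = 3)
    (hTT : ∀ s ∈ T, ∀ t ∈ T, 2 ≤ (s ∩ t).encard → s = t) : Matroid α :=
  (IndepMatroid.ofBddAugment E (fun I ↦ I ⊆ E ∧ I.encard ≤ 3 ∧ I ∉ T)
    (by
      refine ⟨empty_subset E, by simp, fun h ↦ ?_⟩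
      have := hT _ h
      simp at this)
    (by
      rintro I J ⟨hJ, hJ3, hJT⟩ hIJ
      refine ⟨hIJ.trans hJ, (encard_le_encard hIJ).trans hJ3, fun hI ↦ ?_⟩
      have h3 := hT I hI
      have : I = J := ((finite_of_encard_le_coe hJ3).subset hIJ).eq_of_subset_of_encard_le hIJ (h3 ▸ hJ3)
      exact hJT (this ▸ hI))
    (by
      rintro I J ⟨hI, -, -⟩ ⟨hJ, hJ3, hJT⟩ hIJ
      have hIf : I.Finite := finite_of_encard_le_coe (hIJ.le.trans hJ3)
      have hins : ∀ e ∈ J, e ∉ I → insert e I ⊆ E ∧ (insert e I).encard ≤ 3 := fun e he heI ↦ by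
        refine ⟨insert_subset (hJ he) hI, ?_⟩
        rw [encard_insert_of_notMem heI]
        exact (Order.add_one_le_of_lt hIJ).trans hJ3
      obtain ⟨e, he, heI⟩ := not_subset.1 fun h ↦ hIJ.not_ge (encard_le_encard h)
      -- Augmentation by `e` fails only if `I` has two elements and spans the line `insert e I`. By
      -- cardinality `J` can lie in this line only by being equal to it, which is excluded, so `J`
      -- has an element `f` outside. If `insert f I` were a line too, the two lines would share the
      -- pair `I` and coincide.
      by_cases heT : insert e I ∈ T
      swap
      · exact ⟨e, he, heI, (hins e he heI).1, (hins e he heI).2, heT⟩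
      have hI2 : I.encard = 2 := by
        have h := hT _ heT
        rw [encard_insert_of_notMem heI] at h
        exact ENat.add_left_injective_of_ne_top (n := 1) (by decide) h
      have hJI : ¬ J ⊆ insert e I := fun h ↦ hJT <| by
        have hJf : J.Finite := finite_of_encard_le_coe hJ3
        rwa [hJf.eq_of_subset_of_encard_le h]
        rw [hT _ heT]
        have := Order.add_one_le_of_lt hIJ
        rwa [hI2] at this
      obtain ⟨f, hf, hfI⟩ := not_subset.1 hJI
      rw [mem_insert_iff, not_or] at hfI
      refine ⟨f, hf, hfI.2, (hins f hf hfI.2).1, (hins f hf hfI.2).2, fun hfT ↦ ?_⟩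
      have h := hTT _ heT _ hfT <| hI2.ge.trans <|
        encard_le_encard <| subset_inter (subset_insert e I) (subset_insert f I)
      exact ((h ▸ mem_insert f I : f ∈ insert e I).elim hfI.1 hfI.2).elim)
    ⟨3, fun I hI ↦ hI.2.1⟩ (fun I hI ↦ hI.1)).matroid

section

variable {E : Set α} {T : Set (Set α)} {hT : ∀ t ∈ T, t.encard = 3}
  {hTT : ∀ s ∈ T, ∀ t ∈ T, 2 ≤ (s ∩ t).encard → s = t}

theorem ofLines_indep_iff {I : Set α} :
    (ofLines E T hT hTT).Indep I ↔ I ⊆ E ∧ I.encard ≤ 3 ∧ I ∉ T := Iff.rfl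

/-- Subsets of `E` with at most two elements are independent, so lines are minimal dependent sets. A
circuit that is not a line has at least four elements, since smaller sets are independent, and at
most four, since removing an element leaves an independent set. -/
theorem ofLines_isCircuit_iff (hTE : ∀ t ∈ T, t ⊆ E) {C : Set α} :
    (ofLines E T hT hTT).IsCircuit C ↔
      C ∈ T ∨ C ⊆ E ∧ C.encard = 4 ∧ ∀ t ∈ T, ¬ t ⊆ C := by
  have hdep : ∀ t ∈ T, (ofLines E T hT hTT).Dep t := fun t ht ↦
    ⟨fun h ↦ (ofLines_indep_iff.1 h).2.2 ht, hTE t ht⟩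
  have htwo : ∀ I ⊆ E, I.encard ≤ 2 → (ofLines E T hT hTT).Indep I := fun I hI h2 ↦
    ofLines_indep_iff.2 ⟨hI, h2.trans (by decide), fun h ↦ by
      rw [hT I h] at h2
      exact absurd h2 (by decide)⟩
  have hdiff : ∀ (n : ℕ) (C : Set α), C.encard = (n + 1 : ℕ) → ∀ e ∈ C, (C \ {e}).encard = n := by
    intro n C hC e he
    have h := encard_sdiff_singleton_add_one he
    rw [hC] at h
    exact ENat.add_left_injective_of_ne_top (n := 1) (by decide) (by simpa using h)
  constructor
  · intro hC
    by_cases hCT : C ∈ T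
    · exact .inl hCT
    refine .inr ⟨hC.subset_ground, ?_, fun t ht htC ↦ ?_⟩
    · have h4 : 4 ≤ C.encard := by
        by_contra! h
        refine hC.not_indep (ofLines_indep_iff.2 ⟨hC.subset_ground, ?_, hCT⟩)
        exact Order.le_of_lt_add_one (show C.encard < 3 + 1 from h)
      refine h4.antisymm' ?_
      obtain ⟨e, he⟩ := hC.nonempty
      rw [← encard_sdiff_singleton_add_one he]
      exact add_le_add_left (ofLines_indep_iff.1 (hC.sdiff_singleton_indep he)).2.1 1
    · exact hCT (hC.eq_of_dep_subset (hdep t ht) htC ▸ ht)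
  · rw [isCircuit_iff_dep_forall_sdiff_singleton_indep]
    rintro (hC | ⟨hCE, hC4, hC⟩)
    · exact ⟨hdep C hC, fun e he ↦ htwo _ (sdiff_subset.trans (hTE C hC))
        (hdiff 2 C (hT C hC) e he).le⟩
    · refine ⟨⟨fun h ↦ ?_, hCE⟩, fun e he ↦ ofLines_indep_iff.2 ⟨sdiff_subset.trans hCE,
        (hdiff 3 C hC4 e he).le, fun h ↦ hC _ h sdiff_subset⟩⟩
      have := (ofLines_indep_iff.1 h).2.1
      rw [hC4] at this
      exact absurd this (by decide)

theorem ofLines_eRank {B : Set α} (hB : B.encard = 3) (hBE : B ⊆ E) (hBT : B ∉ T) :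
    (ofLines E T hT hTT).eRank = 3 := by
  refine le_antisymm ?_ ?_
  · obtain ⟨B', hB'⟩ := (ofLines E T hT hTT).exists_isBase
    rw [← hB'.encard_eq_eRank]
    exact (ofLines_indep_iff.1 hB'.indep).2.1
  · rw [← hB]
    exact (ofLines_indep_iff.2 ⟨hBE, hB.le, hBT⟩).encard_le_eRank

end

end Matroid

/-! ### Sets of elements as bit masks -/

namespace Elt

/-- The list of all labels. -/
def all : List Elt := [e₁, e₂, a, b, c, d]

theorem mem_all (e : Elt) : e ∈ all := by cases e <;> decide

/-- The position of a label. -/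
def idx : Elt → ℕ
  | e₁ => 0
  | e₂ => 1
  | a => 2
  | b => 3
  | c => 4
  | d => 5

theorem idx_injective : Function.Injective idx := by
  intro e f h
  cases e <;> cases f <;> first | rfl | exact absurd h (by decide)

theorem exists_idx_eq {i : ℕ} (hi : i < 6) : ∃ e : Elt, e.idx = i := by
  interval_cases i
  exacts [⟨e₁, rfl⟩, ⟨e₂, rfl⟩, ⟨a, rfl⟩, ⟨b, rfl⟩, ⟨c, rfl⟩, ⟨d, rfl⟩]

/-- The mask of a single label. -/
def bit (e : Elt) : ℕ := 2 ^ e.idx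

/-- The mask of a list of labels. -/
def mask (l : List Elt) : ℕ := l.foldr (fun e m ↦ bit e ||| m) 0

/-- The set of labels with a given mask. -/
def ofMask (m : ℕ) : Set Elt := {e | m.testBit e.idx}

theorem bit_lt (e : Elt) : bit e < 64 := by cases e <;> decide

theorem or_lt {m n : ℕ} (hm : m < 64) (hn : n < 64) : m ||| n < 64 :=
  Nat.or_lt_two_pow (n := 6) hm hn

theorem mask_lt (l : List Elt) : mask l < 64 := by
  induction l with
  | nil => decide
  | cons e l ih => exact or_lt (bit_lt e) ih

theorem mem_ofMask {m : ℕ} {e : Elt} : e ∈ ofMask m ↔ m.testBit e.idx := Iff.rfl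

theorem ofMask_bit (e : Elt) : ofMask (bit e) = {e} := by
  ext f
  rw [mem_ofMask, bit, Nat.testBit_two_pow, mem_singleton_iff, decide_eq_true_iff,
    idx_injective.eq_iff, eq_comm]

theorem ofMask_or (m n : ℕ) : ofMask (m ||| n) = ofMask m ∪ ofMask n := by
  ext e
  simp [mem_ofMask]

theorem ofMask_and (m n : ℕ) : ofMask (m &&& n) = ofMask m ∩ ofMask n := by
  ext e
  simp [mem_ofMask]

theorem ofMask_mask (l : List Elt) : ofMask (mask l) = {e | e ∈ l} := by
  induction l with
  | nil => ext e; simp [mask, mem_ofMask]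
  | cons f l ih =>
    change ofMask (bit f ||| mask l) = _
    rw [ofMask_or, ofMask_bit, ih]
    ext e
    simp

/-- `ofMask` reads only the bits at positions below six, and masks below `64 = 2 ^ 6` have no
others. This is the origin of the bound `64` throughout. -/
theorem ofMask_injOn {m n : ℕ} (hm : m < 64) (hn : n < 64) : ofMask m = ofMask n ↔ m = n := by
  refine ⟨fun h ↦ Nat.eq_of_testBit_eq fun i ↦ ?_, fun h ↦ h ▸ rfl⟩
  obtain hi | hi := lt_or_ge i 6
  · obtain ⟨e, rfl⟩ := exists_idx_eq hi
    exact Bool.eq_iff_iff.2 (Set.ext_iff.1 h e)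
  · have h6 : 64 ≤ 2 ^ i := Nat.pow_le_pow_right (n := 2) (by decide) hi
    rw [Nat.testBit_eq_false_of_lt (hm.trans_le h6), Nat.testBit_eq_false_of_lt (hn.trans_le h6)]

theorem exists_ofMask_eq (X : Set Elt) : ∃ m < 64, ofMask m = X := by
  classical
  refine ⟨mask (all.filter (· ∈ X)), mask_lt _, ?_⟩
  rw [ofMask_mask]
  ext e
  simp [mem_all]

theorem ofMask_eq_empty {m : ℕ} (hm : m < 64) : ofMask m = ∅ ↔ m = 0 := by
  rw [← ofMask_injOn hm (by decide)]
  simp [ofMask, Set.ext_iff]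

theorem and_lt {m : ℕ} (hm : m < 64) (n : ℕ) : m &&& n < 64 := Nat.and_le_left.trans_lt hm

theorem disjoint_ofMask {m n : ℕ} (hm : m < 64) :
    Disjoint (ofMask m) (ofMask n) ↔ m &&& n = 0 := by
  rw [disjoint_iff_inter_eq_empty, ← ofMask_and, ofMask_eq_empty (and_lt hm n)]

theorem ofMask_subset {m n : ℕ} (hm : m < 64) : ofMask m ⊆ ofMask n ↔ m &&& n = m := by
  rw [← inter_eq_left, ← ofMask_and, ofMask_injOn (and_lt hm n) hm]

/-- The number of elements of the set with a given mask. -/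
def popcount (m : ℕ) : ℕ := (all.filter fun e ↦ m.testBit e.idx).length

theorem encard_ofMask (m : ℕ) : (ofMask m).encard = popcount m := by
  have : ofMask m = ((all.filter fun e ↦ m.testBit e.idx).toFinset : Set Elt) := by
    ext e
    simp [mem_ofMask, mem_all]
  rw [this, encard_coe_eq_coe_finsetCard,
    List.toFinset_card_of_nodup (List.Nodup.filter _ (by decide)), popcount]

end Elt

/-! ### Enumeration of the frame circuits of a biased graph on three vertices -/

namespace MaskGraph

open Elt Graph

section

variable (E : ℕ) (ends : Elt → Sym2 (Fin 3))

/-- The three vertices. -/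
def verts : List (Fin 3) := [0, 1, 2]

/-- The graph with edge set `ofMask E`. -/
abbrev graph : Graph (Fin 3) Elt := ofEnds (ofMask E) ends

/-- The edges joining `x` to `y`. -/
def links (x y : Fin 3) : List ℕ :=
  (all.filter fun e ↦ E.testBit e.idx && decide (ends e = s(x, y))).map bit

/-- The edges incident with `x`. -/
def star (x : Fin 3) : ℕ :=
  mask (all.filter fun e ↦ E.testBit e.idx && decide (x ∈ ends e))

/-- Whether `x` is an end of an edge in the set with mask `m`. -/
def touches (m : ℕ) (x : Fin 3) : Bool := m &&& star E ends x != 0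

/-- Whether `x` is the only vertex that two edge sets have in common. -/
def meetsOnlyAt (m n : ℕ) (x : Fin 3) : Bool :=
  verts.all fun y ↦ (touches E ends m y && touches E ends n y) == decide (y = x)

/-- Whether `x` and `y` are the only vertices that two edge sets have in common. -/
def meetsOnlyAtPair (m n : ℕ) (x y : Fin 3) : Bool :=
  verts.all fun z ↦ (touches E ends m z && touches E ends n z) == decide (z = x ∨ z = y)

/-- Whether two edge sets have no vertex in common. -/
def vertexDisjoint (m n : ℕ) : Bool :=
  verts.all fun y ↦ !(touches E ends m y && touches E ends n y)

/-- All cycles. -/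
def cycles : List ℕ :=
  (verts.flatMap fun x ↦ links E ends x x) ++
  (verts.flatMap fun x ↦ (verts.filter fun y ↦ x < y).flatMap fun y ↦
    (links E ends x y).flatMap fun e ↦
      ((links E ends x y).filter fun f ↦ e < f).map fun f ↦ e ||| f) ++
  ((links E ends 0 1).flatMap fun e ↦ (links E ends 1 2).flatMap fun f ↦
    (links E ends 2 0).map fun g ↦ e ||| (f ||| g))

/-- All paths from `x` to `y`, where `x ≠ y`. -/
def paths (x y : Fin 3) : List ℕ :=
  links E ends x y ++
  (verts.filter fun z ↦ x ≠ z ∧ z ≠ y).flatMap fun z ↦ (links E ends x z).flatMap fun e ↦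
    (links E ends z y).map fun f ↦ e ||| f

/-- All theta subgraphs. -/
def thetas : List (ℕ × ℕ × ℕ) :=
  verts.flatMap fun x ↦ (verts.filter fun y ↦ x ≠ y).flatMap fun y ↦
    (paths E ends x y).flatMap fun P ↦
      ((paths E ends x y).filter fun Q ↦
        P &&& Q == 0 && meetsOnlyAtPair E ends P Q x y).flatMap fun Q ↦
          ((paths E ends x y).filter fun R ↦ Q &&& R == 0 && P &&& R == 0 &&
            meetsOnlyAtPair E ends Q R x y && meetsOnlyAtPair E ends P R x y).map fun R ↦
              (P, Q, R)

variable (bal : ℕ → Bool)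

/-- All unbalanced cycles. -/
def unbalancedCycles : List ℕ := (cycles E ends).filter fun m ↦ !bal m

/-- All tight handcuffs. -/
def tightHandcuffs : List ℕ :=
  (unbalancedCycles E ends bal).flatMap fun C ↦
    ((unbalancedCycles E ends bal).filter fun D ↦
      C &&& D == 0 && verts.any (meetsOnlyAt E ends C D)).map fun D ↦ C ||| D

/-- All loose handcuffs. -/
def looseHandcuffs : List ℕ :=
  (unbalancedCycles E ends bal).flatMap fun C ↦
    ((unbalancedCycles E ends bal).filter fun D ↦ vertexDisjoint E ends C D).flatMap fun D ↦
      verts.flatMap fun x ↦ (verts.filter fun y ↦ x ≠ y).flatMap fun y ↦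
        ((paths E ends x y).filter fun P ↦
          meetsOnlyAt E ends P C x && meetsOnlyAt E ends P D y).map fun P ↦ C ||| P ||| D

/-- All theta subgraphs without balanced cycles. -/
def unbalancedThetas : List ℕ :=
  ((thetas E ends).filter fun t ↦ !bal (t.1 ||| t.2.1) && !bal (t.2.1 ||| t.2.2) &&
    !bal (t.1 ||| t.2.2)).map fun t ↦ t.1 ||| t.2.1 ||| t.2.2

/-- All frame circuits. -/
def frameCircuits : List ℕ :=
  (cycles E ends).filter bal ++ tightHandcuffs E ends bal ++ looseHandcuffs E ends bal ++
    unbalancedThetas E ends bal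

/-- Whether `m` is the mask of a cycle that satisfies `circ`. -/
def isBalanced (circ : ℕ → Bool) (m : ℕ) : Bool := (cycles E ends).contains m && circ m

/-- Whether the sets satisfying `circ` are exactly the frame circuits, if the balanced cycles are
those satisfying `circ`. -/
def isFrame (circ : ℕ → Bool) : Bool :=
  (frameCircuits E ends (isBalanced E ends circ)).all (fun m ↦ decide (m < 64) && circ m) &&
    (List.range 64).all fun m ↦
      !circ m || (frameCircuits E ends (isBalanced E ends circ)).contains m

/-- No theta subgraph has exactly two balanced cycles. -/
def isBiased : Bool :=
  (thetas E ends).all fun t ↦ !bal (t.1 ||| t.2.1) || !bal (t.2.1 ||| t.2.2) ||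
    bal (t.1 ||| t.2.2)

end

variable {E : ℕ} {ends : Elt → Sym2 (Fin 3)}

theorem mem_verts (x : Fin 3) : x ∈ verts := by fin_cases x <;> decide

theorem mem_links {x y : Fin 3} {m : ℕ} :
    m ∈ links E ends x y ↔ ∃ e, (graph E ends).IsLink e x y ∧ bit e = m := by
  simp [links, mem_all, ofEnds, mem_ofMask]

theorem links_lt {x y : Fin 3} {m : ℕ} (hm : m ∈ links E ends x y) : m < 64 := by
  obtain ⟨e, -, rfl⟩ := mem_links.1 hm
  exact bit_lt e

theorem inc_iff {e : Elt} {x : Fin 3} :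
    (graph E ends).Inc e x ↔ e ∈ ofMask E ∧ x ∈ ends e := by
  simp only [Inc, ofEnds, Sym2.mem_iff_exists]
  simp

theorem touches_iff {m : ℕ} (hm : m < 64) {x : Fin 3} :
    touches E ends m x ↔ x ∈ (graph E ends).endVerts (ofMask m) := by
  rw [touches, bne_iff_ne, ne_eq, ← ofMask_eq_empty (and_lt hm _), ofMask_and, star, ofMask_mask,
    ← ne_eq, ← nonempty_iff_ne_empty]
  simp only [endVerts, inc_iff, Set.Nonempty, mem_inter_iff, mem_ofPred_eq, List.mem_filter,
    mem_all, true_and, Bool.and_eq_true, decide_eq_true_iff, mem_ofMask]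

theorem and_beq_decide {p q : Bool} {r : Prop} [Decidable r] :
    ((p && q) == decide r) = true ↔ ((p = true ∧ q = true) ↔ r) := by
  rw [beq_iff_eq, ← Bool.and_eq_true, Bool.eq_iff_iff, decide_eq_true_iff]

theorem meetsOnlyAt_iff {m n : ℕ} (hm : m < 64) (hn : n < 64) {x : Fin 3} :
    meetsOnlyAt E ends m n x ↔
      (graph E ends).endVerts (ofMask m) ∩ (graph E ends).endVerts (ofMask n) = {x} := by
  simp only [meetsOnlyAt, List.all_eq_true, mem_verts, true_imp_iff, and_beq_decide,
    touches_iff hm, touches_iff hn, Set.ext_iff, mem_inter_iff, mem_singleton_iff]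

theorem meetsOnlyAtPair_iff {m n : ℕ} (hm : m < 64) (hn : n < 64) {x y : Fin 3} :
    meetsOnlyAtPair E ends m n x y ↔
      (graph E ends).endVerts (ofMask m) ∩ (graph E ends).endVerts (ofMask n) = {x, y} := by
  simp only [meetsOnlyAtPair, List.all_eq_true, mem_verts, true_imp_iff, and_beq_decide,
    touches_iff hm, touches_iff hn, Set.ext_iff, mem_inter_iff, mem_singleton_iff, mem_insert_iff]

theorem vertexDisjoint_iff {m n : ℕ} (hm : m < 64) (hn : n < 64) :
    vertexDisjoint E ends m n ↔
      Disjoint ((graph E ends).endVerts (ofMask m)) ((graph E ends).endVerts (ofMask n)) := by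
  simp only [vertexDisjoint, List.all_eq_true, mem_verts, true_imp_iff, Bool.not_eq_true',
    ← Bool.not_eq_true, Bool.and_eq_true, touches_iff hm, touches_iff hn, disjoint_left, not_and]

theorem mem_cycles {m : ℕ} : m ∈ cycles E ends ↔
    (∃ x, m ∈ links E ends x x) ∨
    (∃ x y, x < y ∧ ∃ e ∈ links E ends x y, ∃ f ∈ links E ends x y, e < f ∧ e ||| f = m) ∨
    ∃ e ∈ links E ends 0 1, ∃ f ∈ links E ends 1 2, ∃ g ∈ links E ends 2 0,
      e ||| (f ||| g) = m := by
  simp [cycles, mem_verts, and_assoc]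

theorem mem_paths {x y : Fin 3} {m : ℕ} : m ∈ paths E ends x y ↔
    m ∈ links E ends x y ∨
    ∃ z, x ≠ z ∧ z ≠ y ∧ ∃ e ∈ links E ends x z, ∃ f ∈ links E ends z y, e ||| f = m := by
  simp [paths, mem_verts, and_assoc]

theorem cycles_lt {m : ℕ} (hm : m ∈ cycles E ends) : m < 64 := by
  obtain ⟨x, h⟩ | ⟨x, y, -, e, he, f, hf, -, rfl⟩ | ⟨e, he, f, hf, g, hg, rfl⟩ := mem_cycles.1 hm
  · exact links_lt h
  · exact or_lt (links_lt he) (links_lt hf)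
  · exact or_lt (links_lt he) (or_lt (links_lt hf) (links_lt hg))

theorem paths_lt {x y : Fin 3} {m : ℕ} (hm : m ∈ paths E ends x y) : m < 64 := by
  obtain h | ⟨z, -, -, e, he, f, hf, rfl⟩ := mem_paths.1 hm
  · exact links_lt h
  · exact or_lt (links_lt he) (links_lt hf)

theorem isCycleSet_of_mem_cycles {m : ℕ} (hm : m ∈ cycles E ends) :
    (graph E ends).IsCycleSet (ofMask m) := by
  obtain ⟨x, h⟩ | ⟨x, y, hxy, e, he, f, hf, hef, rfl⟩ | ⟨e, he, f, hf, g, hg, rfl⟩ :=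
    mem_cycles.1 hm
  · obtain ⟨e, he, rfl⟩ := mem_links.1 h
    rw [ofMask_bit]
    exact isCycleSet_singleton he
  · obtain ⟨e, he', rfl⟩ := mem_links.1 he
    obtain ⟨f, hf', rfl⟩ := mem_links.1 hf
    rw [ofMask_or, ofMask_bit, ofMask_bit]
    exact isCycleSet_pair (fun h ↦ hef.ne (h ▸ rfl)) hxy.ne he' hf'
  · obtain ⟨e, he', rfl⟩ := mem_links.1 he
    obtain ⟨f, hf', rfl⟩ := mem_links.1 hf
    obtain ⟨g, hg', rfl⟩ := mem_links.1 hg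
    rw [ofMask_or, ofMask_or, ofMask_bit, ofMask_bit, ofMask_bit]
    refine isCycleSet_triangle (by decide) (by decide) (by decide) ?_ ?_ ?_ he' hf' hg'
    · rintro rfl
      exact absurd (he'.2.symm.trans hf'.2) (by decide)
    · rintro rfl
      exact absurd (hf'.2.symm.trans hg'.2) (by decide)
    · rintro rfl
      exact absurd (he'.2.symm.trans hg'.2) (by decide)

/-- The enumeration lists a pair of parallel links only with increasing vertices and increasing
masks, and a triangle only as read from `0` to `1` to `2`. A given cycle can start anywhere and run
in either direction, so it has to be normalised; for triangles this means six placements of the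
vertices. -/
theorem exists_mem_cycles {C : Set Elt} (hC : (graph E ends).IsCycleSet C) :
    ∃ m ∈ cycles E ends, ofMask m = C := by
  obtain ⟨e, x, he, rfl⟩ | ⟨e, f, x, y, hef, hxy, he, hf, rfl⟩ | ⟨n, v, e, hv, he, hl, rfl⟩ :=
    hC.cases
  · exact ⟨bit e, mem_cycles.2 (.inl ⟨x, mem_links.2 ⟨e, he, rfl⟩⟩), ofMask_bit e⟩
  · wlog hlt : x < y generalizing x y
    · exact this y x hxy.symm he.symm hf.symm (hxy.lt_or_gt.resolve_left hlt)
    wlog hltb : bit e < bit f generalizing e f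
    · have hne : bit e ≠ bit f := fun h ↦ hef <| by
        rw [← singleton_eq_singleton_iff, ← ofMask_bit, ← ofMask_bit, h]
      obtain ⟨m, hm, h⟩ := this f e hef.symm (by rwa [pair_comm]) hf he
        (hne.lt_or_gt.resolve_left hltb)
      exact ⟨m, hm, h.trans (pair_comm _ _)⟩
    refine ⟨bit e ||| bit f, mem_cycles.2 (.inr (.inl ⟨x, y, hlt, _, mem_links.2 ⟨e, he, rfl⟩, _,
      mem_links.2 ⟨f, hf, rfl⟩, hltb, rfl⟩)), ?_⟩
    rw [ofMask_or, ofMask_bit, ofMask_bit]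
    rfl
  · obtain rfl : n = 0 := by
      have := Fintype.card_le_of_injective v hv
      simp at this
      omega
    have tri : ∀ i j k, (∀ l, l = i ∨ l = j ∨ l = k) → (graph E ends).IsLink (e i) 0 1 →
        (graph E ends).IsLink (e j) 1 2 → (graph E ends).IsLink (e k) 2 0 →
        ∃ m ∈ cycles E ends, ofMask m = range e := by
      intro i j k hijk h1 h2 h3
      refine ⟨_, mem_cycles.2 (.inr (.inr ⟨_, mem_links.2 ⟨_, h1, rfl⟩, _, mem_links.2 ⟨_, h2, rfl⟩,
        _, mem_links.2 ⟨_, h3, rfl⟩, rfl⟩)), ?_⟩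
      rw [ofMask_or, ofMask_or, ofMask_bit, ofMask_bit, ofMask_bit]
      ext t
      constructor
      · rintro (rfl | rfl | rfl) <;> exact mem_range_self _
      · rintro ⟨l, rfl⟩
        obtain rfl | rfl | rfl := hijk l
        exacts [.inl rfl, .inr (.inl rfl), .inr (.inr rfl)]
    have h0 : (graph E ends).IsLink (e 0) (v 0) (v 1) := hl 0
    have h1 : (graph E ends).IsLink (e 1) (v 1) (v 2) := hl 1
    have h2 : (graph E ends).IsLink (e 2) (v 2) (v 0) := hl 2
    have h01 : v 0 ≠ v 1 := hv.ne (by decide)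
    have h12 : v 1 ≠ v 2 := hv.ne (by decide)
    have h02 : v 0 ≠ v 2 := hv.ne (by decide)
    generalize v 0 = x at *
    generalize v 1 = y at *
    generalize v 2 = z at *
    fin_cases x <;> fin_cases y <;> fin_cases z <;>
      first
      | exact absurd rfl h01
      | exact absurd rfl h12
      | exact absurd rfl h02
      | exact tri 0 1 2 (by decide) h0 h1 h2
      | exact tri 1 2 0 (by decide) h1 h2 h0
      | exact tri 2 0 1 (by decide) h2 h0 h1
      | exact tri 2 1 0 (by decide) h2.symm h1.symm h0.symm
      | exact tri 1 0 2 (by decide) h1.symm h0.symm h2.symm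
      | exact tri 0 2 1 (by decide) h0.symm h2.symm h1.symm

theorem isBalanced_iff {circ : ℕ → Bool} {m : ℕ} :
    isBalanced E ends circ m ↔ m ∈ cycles E ends ∧ circ m := by
  simp [isBalanced]

theorem isBalanced_lt {circ : ℕ → Bool} {m : ℕ} (hm : isBalanced E ends circ m) : m < 64 :=
  cycles_lt (isBalanced_iff.1 hm).1

theorem isPathSet_of_mem_paths {x y : Fin 3} (hxy : x ≠ y) {m : ℕ} (hm : m ∈ paths E ends x y) :
    (graph E ends).IsPathSet x y (ofMask m) := by
  obtain h | ⟨z, hxz, hzy, e, he, f, hf, rfl⟩ := mem_paths.1 hm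
  · obtain ⟨e, he, rfl⟩ := mem_links.1 h
    rw [ofMask_bit]
    exact isPathSet_singleton hxy he
  · obtain ⟨e, he', rfl⟩ := mem_links.1 he
    obtain ⟨f, hf', rfl⟩ := mem_links.1 hf
    rw [ofMask_or, ofMask_bit, ofMask_bit]
    exact isPathSet_pair hxz hzy hxy he' hf'

theorem exists_mem_paths {x y : Fin 3} (hxy : x ≠ y) {P : Set Elt}
    (hP : (graph E ends).IsPathSet x y P) : ∃ m ∈ paths E ends x y, ofMask m = P := by
  obtain ⟨h, -⟩ | ⟨-, e, he, rfl⟩ | ⟨z, e, f, hxz, hzy, -, he, hf, rfl⟩ | ⟨n, v, e, hv, -⟩ :=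
    hP.cases
  · exact (hxy h).elim
  · exact ⟨bit e, mem_paths.2 (.inl (mem_links.2 ⟨e, he, rfl⟩)), ofMask_bit e⟩
  · refine ⟨bit e ||| bit f, mem_paths.2 (.inr ⟨z, hxz, hzy, _, mem_links.2 ⟨e, he, rfl⟩, _,
      mem_links.2 ⟨f, hf, rfl⟩, rfl⟩), ?_⟩
    rw [ofMask_or, ofMask_bit, ofMask_bit]
    rfl
  · have := Fintype.card_le_of_injective v hv
    simp at this

theorem mem_thetas {P Q R : ℕ} : (P, Q, R) ∈ thetas E ends ↔ ∃ x y, x ≠ y ∧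
    P ∈ paths E ends x y ∧ Q ∈ paths E ends x y ∧ R ∈ paths E ends x y ∧
    P &&& Q = 0 ∧ Q &&& R = 0 ∧ P &&& R = 0 ∧ meetsOnlyAtPair E ends P Q x y ∧
    meetsOnlyAtPair E ends Q R x y ∧ meetsOnlyAtPair E ends P R x y := by
  simp only [thetas, List.mem_flatMap, List.mem_filter, List.mem_map, mem_verts, true_and,
    Bool.and_eq_true, beq_iff_eq, decide_eq_true_iff, Prod.mk.injEq]
  constructor
  · rintro ⟨x, y, hxy, _, hP, _, ⟨hQ, h1, h2⟩, _, ⟨hR, ⟨⟨h3, h4⟩, h5⟩, h6⟩, rfl, rfl, rfl⟩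
    exact ⟨x, y, hxy, hP, hQ, hR, h1, h3, h4, h2, h5, h6⟩
  · rintro ⟨x, y, hxy, hP, hQ, hR, h1, h3, h4, h2, h5, h6⟩
    exact ⟨x, y, hxy, _, hP, _, ⟨hQ, h1, h2⟩, _, ⟨hR, ⟨⟨h3, h4⟩, h5⟩, h6⟩, rfl, rfl, rfl⟩

theorem thetas_lt {P Q R : ℕ} (h : (P, Q, R) ∈ thetas E ends) : P < 64 ∧ Q < 64 ∧ R < 64 := by
  obtain ⟨x, y, -, hP, hQ, hR, -⟩ := mem_thetas.1 h
  exact ⟨paths_lt hP, paths_lt hQ, paths_lt hR⟩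

theorem isTheta_of_mem_thetas {P Q R : ℕ} (h : (P, Q, R) ∈ thetas E ends) :
    (graph E ends).IsTheta (ofMask P) (ofMask Q) (ofMask R) := by
  obtain ⟨x, y, hxy, hP, hQ, hR, h1, h2, h3, h4, h5, h6⟩ := mem_thetas.1 h
  have hP' := paths_lt hP
  have hQ' := paths_lt hQ
  have hR' := paths_lt hR
  exact ⟨x, y, hxy, isPathSet_of_mem_paths hxy hP, isPathSet_of_mem_paths hxy hQ,
    isPathSet_of_mem_paths hxy hR, (disjoint_ofMask hP').2 h1, (disjoint_ofMask hQ').2 h2,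
    (disjoint_ofMask hP').2 h3, (meetsOnlyAtPair_iff hP' hQ').1 h4,
    (meetsOnlyAtPair_iff hQ' hR').1 h5, (meetsOnlyAtPair_iff hP' hR').1 h6⟩

theorem exists_mem_thetas {P Q R : Set Elt} (h : (graph E ends).IsTheta P Q R) :
    ∃ p q r, (p, q, r) ∈ thetas E ends ∧ ofMask p = P ∧ ofMask q = Q ∧ ofMask r = R := by
  obtain ⟨x, y, hxy, hP, hQ, hR, h1, h2, h3, h4, h5, h6⟩ := h
  obtain ⟨p, hp, rfl⟩ := exists_mem_paths hxy hP
  obtain ⟨q, hq, rfl⟩ := exists_mem_paths hxy hQ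
  obtain ⟨r, hr, rfl⟩ := exists_mem_paths hxy hR
  have hp' := paths_lt hp
  have hq' := paths_lt hq
  have hr' := paths_lt hr
  exact ⟨p, q, r, mem_thetas.2 ⟨x, y, hxy, hp, hq, hr, (disjoint_ofMask hp').1 h1,
    (disjoint_ofMask hq').1 h2, (disjoint_ofMask hp').1 h3, (meetsOnlyAtPair_iff hp' hq').2 h4,
    (meetsOnlyAtPair_iff hq' hr').2 h5, (meetsOnlyAtPair_iff hp' hr').2 h6⟩, rfl, rfl, rfl⟩

variable {bal : ℕ → Bool} {Ω : BiasedGraph (Fin 3) Elt}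

theorem mem_unbalancedCycles {m : ℕ} : m ∈ unbalancedCycles E ends bal ↔
    m ∈ cycles E ends ∧ ¬ bal m := by
  simp [unbalancedCycles]

theorem mem_tightHandcuffs {m : ℕ} : m ∈ tightHandcuffs E ends bal ↔
    ∃ C ∈ unbalancedCycles E ends bal, ∃ D ∈ unbalancedCycles E ends bal,
      C &&& D = 0 ∧ (∃ x, meetsOnlyAt E ends C D x) ∧ C ||| D = m := by
  simp [tightHandcuffs, mem_verts, and_assoc]

theorem mem_looseHandcuffs {m : ℕ} : m ∈ looseHandcuffs E ends bal ↔
    ∃ C ∈ unbalancedCycles E ends bal, ∃ D ∈ unbalancedCycles E ends bal,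
      vertexDisjoint E ends C D ∧ ∃ x y, x ≠ y ∧ ∃ P ∈ paths E ends x y,
        meetsOnlyAt E ends P C x ∧ meetsOnlyAt E ends P D y ∧ C ||| P ||| D = m := by
  simp [looseHandcuffs, mem_verts, and_assoc]

theorem mem_unbalancedThetas {m : ℕ} : m ∈ unbalancedThetas E ends bal ↔
    ∃ P Q R, (P, Q, R) ∈ thetas E ends ∧ ¬ bal (P ||| Q) ∧ ¬ bal (Q ||| R) ∧ ¬ bal (P ||| R) ∧
      P ||| Q ||| R = m := by
  simp [unbalancedThetas, and_assoc]

theorem isUnbalancedCycle_of_mem (hG : Ω.graph = graph E ends)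
    (hb : ∀ m < 64, ofMask m ∈ Ω.balanced ↔ bal m) {m : ℕ}
    (hm : m ∈ unbalancedCycles E ends bal) : Ω.IsUnbalancedCycle (ofMask m) := by
  rw [mem_unbalancedCycles] at hm
  have h : Ω.graph.IsCycleSet (ofMask m) := hG ▸ isCycleSet_of_mem_cycles hm.1
  exact ⟨h, fun h' ↦ hm.2 ((hb m (cycles_lt hm.1)).1 h')⟩

theorem exists_mem_unbalancedCycles (hG : Ω.graph = graph E ends)
    (hb : ∀ m < 64, ofMask m ∈ Ω.balanced ↔ bal m) {C : Set Elt}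
    (hC : Ω.IsUnbalancedCycle C) : ∃ m ∈ unbalancedCycles E ends bal, ofMask m = C := by
  obtain ⟨h, hC⟩ := hC
  obtain ⟨m, hm, rfl⟩ := exists_mem_cycles (hG ▸ h)
  exact ⟨m, mem_unbalancedCycles.2 ⟨hm, fun h' ↦ hC ((hb m (cycles_lt hm)).2 h')⟩, rfl⟩

theorem unbalancedCycles_lt {m : ℕ} (hm : m ∈ unbalancedCycles E ends bal) : m < 64 :=
  cycles_lt (mem_unbalancedCycles.1 hm).1

/-- Soundness of the enumeration, for any biased graph on the given graph whose balanced sets are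
described by `bal`; `exists_mem_frameCircuits` is its completeness. -/
theorem isFrameCircuit_of_mem_frameCircuits (hG : Ω.graph = graph E ends)
    (hb : ∀ m < 64, ofMask m ∈ Ω.balanced ↔ bal m) {m : ℕ}
    (hm : m ∈ frameCircuits E ends bal) : Ω.IsFrameCircuit (ofMask m) := by
  simp only [frameCircuits, List.mem_append, List.mem_filter] at hm
  obtain ((⟨hm, hb'⟩ | h) | h) | h := hm
  · exact .inl ((hb m (cycles_lt hm)).2 hb')
  · obtain ⟨C, hC, D, hD, h1, ⟨x, hx⟩, rfl⟩ := mem_tightHandcuffs.1 h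
    have hC' := unbalancedCycles_lt hC
    rw [meetsOnlyAt_iff hC' (unbalancedCycles_lt hD), ← hG] at hx
    exact .inr (.inl ⟨_, _, isUnbalancedCycle_of_mem hG hb hC, isUnbalancedCycle_of_mem hG hb hD,
      (disjoint_ofMask hC').2 h1, ⟨x, hx⟩, ofMask_or _ _⟩)
  · obtain ⟨C, hC, D, hD, h1, x, y, hxy, P, hP, hx, hy, rfl⟩ := mem_looseHandcuffs.1 h
    have hC' := unbalancedCycles_lt hC
    have hD' := unbalancedCycles_lt hD
    rw [vertexDisjoint_iff hC' hD', ← hG] at h1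
    rw [meetsOnlyAt_iff (paths_lt hP) hC', ← hG] at hx
    rw [meetsOnlyAt_iff (paths_lt hP) hD', ← hG] at hy
    exact .inr (.inr (.inl ⟨_, _, _, x, y, isUnbalancedCycle_of_mem hG hb hC,
      isUnbalancedCycle_of_mem hG hb hD, h1, hG ▸ isPathSet_of_mem_paths hxy hP, hx, hy,
      by rw [ofMask_or, ofMask_or]⟩))
  · obtain ⟨P, Q, R, ht, h1, h2, h3, rfl⟩ := mem_unbalancedThetas.1 h
    obtain ⟨hP, hQ, hR⟩ := thetas_lt ht
    have hθ := isTheta_of_mem_thetas ht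
    rw [← hG] at hθ
    refine .inr (.inr (.inr ⟨_, _, _, hθ, ?_, ?_, ?_, by rw [ofMask_or, ofMask_or]⟩)) <;>
    rw [← ofMask_or, hb _ (or_lt ‹_› ‹_›)] <;> assumption

theorem exists_mem_frameCircuits (hG : Ω.graph = graph E ends)
    (hb : ∀ m < 64, ofMask m ∈ Ω.balanced ↔ bal m) {X : Set Elt}
    (hX : Ω.IsFrameCircuit X) : ∃ m ∈ frameCircuits E ends bal, ofMask m = X := by
  simp only [frameCircuits, List.mem_append, List.mem_filter]
  obtain hX | ⟨C, D, hC, hD, h1, ⟨x, hx⟩, rfl⟩ | ⟨C, D, P, x, y, hC, hD, h1, hP, hx, hy, rfl⟩ |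
    ⟨P, Q, R, h, h1, h2, h3, rfl⟩ := hX
  · have h := Ω.isCycleSet_of_balanced X hX
    obtain ⟨m, hm, rfl⟩ := exists_mem_cycles (hG ▸ h)
    exact ⟨m, .inl (.inl (.inl ⟨hm, (hb m (cycles_lt hm)).1 hX⟩)), rfl⟩
  · obtain ⟨C, hCm, rfl⟩ := exists_mem_unbalancedCycles hG hb hC
    obtain ⟨D, hDm, rfl⟩ := exists_mem_unbalancedCycles hG hb hD
    have hC' := unbalancedCycles_lt hCm
    rw [hG, ← meetsOnlyAt_iff hC' (unbalancedCycles_lt hDm)] at hx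
    exact ⟨C ||| D, .inl (.inl (.inr (mem_tightHandcuffs.2
      ⟨C, hCm, D, hDm, (disjoint_ofMask hC').1 h1, ⟨x, hx⟩, rfl⟩))), ofMask_or _ _⟩
  · obtain ⟨C, hCm, rfl⟩ := exists_mem_unbalancedCycles hG hb hC
    obtain ⟨D, hDm, rfl⟩ := exists_mem_unbalancedCycles hG hb hD
    -- Only paths between distinct vertices are enumerated; the ends differ since they lie on
    -- vertex-disjoint cycles.
    have hxy : x ≠ y := by
      rintro rfl
      exact disjoint_left.1 h1 (hx.ge rfl).2 (hy.ge rfl).2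
    obtain ⟨P, hPm, rfl⟩ := exists_mem_paths hxy (hG ▸ hP)
    have hC' := unbalancedCycles_lt hCm
    have hD' := unbalancedCycles_lt hDm
    rw [hG, ← vertexDisjoint_iff hC' hD'] at h1
    rw [hG, ← meetsOnlyAt_iff (paths_lt hPm) hC'] at hx
    rw [hG, ← meetsOnlyAt_iff (paths_lt hPm) hD'] at hy
    exact ⟨C ||| P ||| D, .inl (.inr (mem_looseHandcuffs.2
      ⟨C, hCm, D, hDm, h1, x, y, hxy, P, hPm, hx, hy, rfl⟩)), by rw [ofMask_or, ofMask_or]⟩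
  · obtain ⟨P, Q, R, ht, rfl, rfl, rfl⟩ := exists_mem_thetas (hG ▸ h)
    obtain ⟨hP, hQ, hR⟩ := thetas_lt ht
    rw [← ofMask_or, hb _ (or_lt ‹_› ‹_›)] at h1 h2 h3
    exact ⟨P ||| Q ||| R, .inr (mem_unbalancedThetas.2 ⟨P, Q, R, ht, h1, h2, h3, rfl⟩),
      by rw [ofMask_or, ofMask_or]⟩

/-- The biased graph on `graph E ends` whose balanced cycles are the cycles with mask
satisfying `circ`. -/
def biasedGraph (E : ℕ) (ends : Elt → Sym2 (Fin 3)) (circ : ℕ → Bool)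
    (h : isBiased E ends (isBalanced E ends circ)) : BiasedGraph (Fin 3) Elt where
  graph := graph E ends
  balanced := {C | ∃ m, isBalanced E ends circ m ∧ ofMask m = C}
  isCycleSet_of_balanced := by
    rintro _ ⟨m, hm, rfl⟩
    exact isCycleSet_of_mem_cycles (isBalanced_iff.1 hm).1
  theta_property := by
    rintro _ _ _ hθ ⟨m, hm, hmPQ⟩ ⟨n, hn, hnQR⟩
    obtain ⟨P, Q, R, ht, rfl, rfl, rfl⟩ := exists_mem_thetas hθ
    obtain ⟨hP, hQ, hR⟩ := thetas_lt ht
    rw [← ofMask_or, ofMask_injOn (isBalanced_lt hm) (or_lt hP hQ)] at hmPQ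
    rw [← ofMask_or, ofMask_injOn (isBalanced_lt hn) (or_lt hQ hR)] at hnQR
    subst hmPQ hnQR
    refine ⟨P ||| R, ?_, ofMask_or _ _⟩
    have := List.all_eq_true.1 h _ ht
    simpa [hm, hn] using this

theorem mem_balanced_biasedGraph {circ : ℕ → Bool}
    {h : isBiased E ends (isBalanced E ends circ)} {m : ℕ} (hm : m < 64) :
    ofMask m ∈ (biasedGraph E ends circ h).balanced ↔ isBalanced E ends circ m := by
  constructor
  · rintro ⟨n, hn, hnm⟩
    rw [ofMask_injOn (isBalanced_lt hn) hm] at hnm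
    exact hnm ▸ hn
  · exact fun h ↦ ⟨m, h, rfl⟩

/-- Reduces representation to a Boolean check. Taking the cycles that satisfy `circ` as the balanced
ones is no restriction: balanced cycles are circuits, and an unbalanced cycle is not a frame
circuit. -/
theorem represents_of_isFrame {M : Matroid Elt} {circ : ℕ → Bool} (hG : Ω.graph = graph E ends)
    (hE : M.E = ofMask E) (hM : ∀ m < 64, M.IsCircuit (ofMask m) ↔ circ m)
    (hb : ∀ m < 64, ofMask m ∈ Ω.balanced ↔ isBalanced E ends circ m)
    (h : isFrame E ends circ) : Ω.Represents M := by
  simp only [isFrame, Bool.and_eq_true, List.all_eq_true, decide_eq_true_iff, List.mem_range,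
    Bool.or_eq_true, Bool.not_eq_true', List.contains_iff_mem] at h
  refine ⟨by rw [hE, hG]; rfl, fun X ↦ ⟨fun hX ↦ ?_, fun hX ↦ ?_⟩⟩
  · obtain ⟨m, hm, rfl⟩ := exists_ofMask_eq X
    rw [hM m hm] at hX
    exact isFrameCircuit_of_mem_frameCircuits hG hb ((h.2 m hm).resolve_left (by simp [hX]))
  · obtain ⟨m, hm, rfl⟩ := exists_mem_frameCircuits hG hb hX
    exact (hM m (h.1 m hm).1).2 (h.1 m hm).2

end MaskGraph

/-! ### The matroids of `Ω₀, …, Ω₇` -/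

namespace MaskGraph

open Elt

/-- Whether `m` is the mask of a circuit of the matroid of rank three on `ofMask E` whose
three-element lines have the masks in `T`. -/
def isLineCircuit (E : ℕ) (T : List ℕ) (m : ℕ) : Bool :=
  m &&& E == m && (T.contains m || popcount m == 4 && T.all fun t ↦ t &&& m != t)

/-- If a matroidal has the same circuits as a biased graph on three vertices in which the elements
of `L` are loops, then it is frame. -/
theorem isFrame_matroidal {X : Matroidal Elt} {E : ℕ} {ends : Elt → Sym2 (Fin 3)}
    {circ : ℕ → Bool} (hE : X.matroid.E = ofMask E)
    (hM : ∀ m < 64, X.matroid.IsCircuit (ofMask m) ↔ circ m)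
    (h₁ : isBiased E ends (isBalanced E ends circ)) (h₂ : isFrame E ends circ)
    (hL : ∀ e ∈ X.L, (ends e).IsDiag) : X.IsFrame := by
  have hΩ : (biasedGraph E ends circ h₁).Represents X.matroid :=
    represents_of_isFrame rfl hE hM (fun m hm ↦ mem_balanced_biasedGraph hm) h₂
  refine ⟨Fin 3, biasedGraph E ends circ h₁, Set.toFinite _, hΩ, fun e he hl ↦ ⟨?_, fun hb ↦ hl ?_⟩⟩
  · have heE : e ∈ ofMask E := hE ▸ X.L_subset he
    exact ⟨(ends e).diagElem (hL e he), heE, (Sym2.diag_diagElem (hL e he)).symm⟩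
  -- A balanced loop of the graph would be a loop of the matroid.
  · exact Matroid.singleton_isCircuit.1 ((hΩ.2 _).2 (.inl hb))

end MaskGraph

namespace Matroidal

open Elt MaskGraph

/-- The masks of the edge sets of `Ω₀, …, Ω₇`. -/
def groundMask : Fin 8 → ℕ := ![31, 31, 63, 63, 63, 63, 63, 63]

/-- The three-element lines of `M₀, …, M₇`. -/
def lines : Fin 8 → List ℕ :=
  ![[mask [a, b, c]],
    [],
    [mask [e₁, b, d], mask [e₂, c, d], mask [a, b, e₂]],
    [mask [a, b, e₂], mask [c, d, e₂]],
    [mask [e₁, a, b], mask [e₁, c, d], mask [a, c, e₂], mask [b, d, e₂]],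
    [mask [e₁, a, b], mask [e₁, c, d], mask [a, c, e₂]],
    [mask [e₁, a, b], mask [e₁, c, d]],
    [mask [e₁, c, d], mask [a, c, e₂], mask [b, d, e₂]]]

theorem popcount_lines : ∀ i, ∀ t ∈ lines i, popcount t = 3 := by decide +kernel

theorem lines_lt : ∀ i, ∀ t ∈ lines i, t < 64 := by decide +kernel

theorem lines_subset : ∀ i, ∀ t ∈ lines i, t &&& groundMask i = t := by decide +kernel

theorem eq_of_popcount_and_lines :
    ∀ i, ∀ s ∈ lines i, ∀ t ∈ lines i, 2 ≤ popcount (s &&& t) → s = t := by decide +kernel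

/-- The matroids `M₀, …, M₇`. -/
def lineMatroid (i : Fin 8) : Matroid Elt :=
  Matroid.ofLines (ofMask (groundMask i)) {X | ∃ t ∈ lines i, ofMask t = X}
    (by
      rintro _ ⟨t, ht, rfl⟩
      rw [encard_ofMask, popcount_lines i t ht]
      rfl)
    (by
      rintro _ ⟨s, hs, rfl⟩ _ ⟨t, ht, rfl⟩ h
      rw [← ofMask_and, encard_ofMask] at h
      rw [eq_of_popcount_and_lines i s hs t ht (by exact_mod_cast h)])

theorem exists_line_iff {i : Fin 8} {m : ℕ} (hm : m < 64) :
    (∃ t ∈ lines i, ofMask t = ofMask m) ↔ m ∈ lines i := by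
  constructor
  · rintro ⟨t, ht, h⟩
    rwa [← (ofMask_injOn (lines_lt i t ht) hm).1 h]
  · exact fun h ↦ ⟨m, h, rfl⟩

theorem isCircuit_lineMatroid {i : Fin 8} {m : ℕ} (hm : m < 64) :
    (lineMatroid i).IsCircuit (ofMask m) ↔ isLineCircuit (groundMask i) (lines i) m := by
  rw [lineMatroid, Matroid.ofLines_isCircuit_iff]
  · simp only [mem_ofPred_eq, exists_line_iff hm, isLineCircuit, Bool.and_eq_true, beq_iff_eq,
      Bool.or_eq_true, List.contains_iff_mem, List.all_eq_true, bne_iff_ne, ofMask_subset hm,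
      encard_ofMask, forall_exists_index, and_imp, forall_apply_eq_imp_iff₂]
    have h4 : ((popcount m : ℕ∞) = 4) ↔ popcount m = 4 := by norm_cast
    have hs : (∀ t ∈ lines i, ¬ ofMask t ⊆ ofMask m) ↔ ∀ t ∈ lines i, t &&& m ≠ t :=
      forall₂_congr fun t ht ↦ by rw [ofMask_subset (lines_lt i t ht)]
    rw [h4, hs]
    have := lines_subset i m
    tauto
  · rintro _ ⟨t, ht, rfl⟩
    exact (ofMask_subset (lines_lt i t ht)).2 (lines_subset i t ht)

theorem indep_lineMatroid {i : Fin 8} {m : ℕ} (hm : m < 64) (h : m &&& groundMask i = m)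
    (h3 : popcount m ≤ 3) (hl : m ∉ lines i) : (lineMatroid i).Indep (ofMask m) := by
  refine Matroid.ofLines_indep_iff.2 ⟨(ofMask_subset hm).2 h, ?_, fun h ↦ hl ?_⟩
  · rw [encard_ofMask]
    exact_mod_cast h3
  · exact (exists_line_iff hm).1 h

/-- The set `{e₁, e₂, a}` is a basis of all eight matroids. It yields the rank, the independence of
`{e₁, e₂}` and `L ⊆ E` uniformly in `i`. -/
theorem basis_lineMatroid : ∀ i, mask [e₁, e₂, a] &&& groundMask i = mask [e₁, e₂, a] ∧
    mask [e₁, e₂, a] ∉ lines i := by decide +kernel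

theorem eRank_lineMatroid (i : Fin 8) : (lineMatroid i).eRank = 3 := by
  have hm := mask_lt [e₁, e₂, a]
  refine Matroid.ofLines_eRank (B := ofMask (mask [e₁, e₂, a])) ?_ ?_ ?_
  · rw [encard_ofMask]
    rfl
  · exact (ofMask_subset hm).2 (basis_lineMatroid i).1
  · exact fun h ↦ (basis_lineMatroid i).2 ((exists_line_iff hm).1 h)

/-- The matroidals `(M₀, L₀), …, (M₇, L₇)`. -/
def lineMatroidal (i : Fin 8) : Matroidal Elt where
  matroid := lineMatroid i
  L := {e₁, e₂}
  L_subset := by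
    have h : ofMask (mask [e₁, e₂, a]) ⊆ ofMask (groundMask i) :=
      (ofMask_subset (mask_lt _)).2 (basis_lineMatroid i).1
    rintro _ (rfl | rfl) <;> exact h (by rw [ofMask_mask]; simp)
  ground_finite := by
    refine (Set.Finite.subset (List.finite_toSet all)) fun e _ ↦ mem_all e

theorem isNonloop_lineMatroid {i : Fin 8} {e : Elt} (he : e ∈ (lineMatroid i).E) :
    (lineMatroid i).IsNonloop e := by
  rw [← Matroid.indep_singleton, ← ofMask_bit]
  refine indep_lineMatroid (bit_lt e) ?_ (by cases e <;> decide) fun h ↦ ?_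
  · rw [← ofMask_subset (bit_lt e), ofMask_bit, singleton_subset_iff]
    exact he
  · have h3 := popcount_lines i _ h
    have h1 : popcount (bit e) = 1 := by cases e <;> decide
    omega

/-! ### The matroidals are not frame -/

theorem ne_and_notMem_of_nodup {α : Type*} {p q f g : α} (h : [p, q, f, g].Nodup) :
    f ≠ g ∧ f ∉ ({p, q} : Set α) ∧ g ∉ ({p, q} : Set α) := by
  simp only [List.nodup_cons, List.mem_cons, List.not_mem_nil, not_or, mem_insert_iff,
    mem_singleton_iff] at h ⊢
  tauto

/-- The rules of `IsFrame.exists_incidence` with their hypotheses bundled into decidable conditions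
on masks, so that each instance can be settled by evaluation. -/
theorem lineMatroidal_exists_incidence {i : Fin 8} (hX : (lineMatroidal i).IsFrame) :
    ∃ p : Elt → Prop,
      (∀ f g, [e₁, e₂, f, g].Nodup ∧
        isLineCircuit (groundMask i) (lines i) (mask [e₁, e₂, f, g]) → (p f ↔ ¬ p g)) ∧
      (∀ f g f' g', [e₁, e₂, f, f'].Nodup ∧ [e₁, e₂, g, g'].Nodup ∧
        isLineCircuit (groundMask i) (lines i) (mask [e₁, e₂, f, f']) ∧
        isLineCircuit (groundMask i) (lines i) (mask [e₁, e₂, g, g']) ∧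
        isLineCircuit (groundMask i) (lines i) (mask [e₁, f, g]) → p f ∧ p g) ∧
      (∀ f g k, f ≠ g ∧ [e₁, e₂, f, k].Nodup ∧ [e₁, e₂, g, k].Nodup ∧
        isLineCircuit (groundMask i) (lines i) (mask [e₁, e₂, f, k]) ∧
        isLineCircuit (groundMask i) (lines i) (mask [e₁, e₂, g, k]) ∧
        mask [e₁, f, g] &&& groundMask i = mask [e₁, f, g] ∧ popcount (mask [e₁, f, g]) ≤ 3 ∧
        mask [e₁, f, g] ∉ lines i → p k) := by
  have four : ∀ f g : Elt, ofMask (mask [e₁, e₂, f, g]) = {e₁, e₂, f, g} := fun f g ↦ by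
    rw [ofMask_mask]; ext; simp
  have three : ∀ f g : Elt, ofMask (mask [e₁, f, g]) = {e₁, f, g} := fun f g ↦ by
    rw [ofMask_mask]; ext; simp
  have hc4 : ∀ f g, isLineCircuit (groundMask i) (lines i) (mask [e₁, e₂, f, g]) →
      (lineMatroid i).IsCircuit {e₁, e₂, f, g} := fun f g h ↦
    four f g ▸ (isCircuit_lineMatroid (mask_lt _)).2 h
  have hi : (lineMatroid i).Indep {e₁, e₂} := by
    refine (indep_lineMatroid (mask_lt [e₁, e₂, a]) (basis_lineMatroid i).1 (by decide)
      (basis_lineMatroid i).2).subset ?_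
    rw [ofMask_mask]
    rintro _ (rfl | rfl) <;> simp
  obtain ⟨p, h1, h2, h3⟩ := hX.exists_incidence (mem_insert e₁ _) (mem_insert_of_mem _ rfl) hi
    (by decide)
  refine ⟨p, ?_, ?_, ?_⟩
  · rintro f g ⟨hn, hc⟩
    obtain ⟨hfg, hf, hg⟩ := ne_and_notMem_of_nodup hn
    exact h1 f g hfg hf hg (hc4 f g hc)
  · rintro f g f' g' ⟨hn, hn', hc, hc', h⟩
    obtain ⟨hff, hf, hf'⟩ := ne_and_notMem_of_nodup hn
    obtain ⟨hgg, hg, hg'⟩ := ne_and_notMem_of_nodup hn'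
    exact h2 f g f' g' hff hgg hf hg hf' hg' (hc4 f f' hc) (hc4 g g' hc')
      (three f g ▸ (isCircuit_lineMatroid (mask_lt _)).2 h)
  · rintro f g k ⟨hfg, hfk, hgk, hc, hc', hE, h3', hl⟩
    obtain ⟨hfk, hf, hk⟩ := ne_and_notMem_of_nodup hfk
    obtain ⟨hgk, hg, -⟩ := ne_and_notMem_of_nodup hgk
    exact h3 f g k hfg hfk hgk hf hg hk (hc4 f k hc) (hc4 g k hc')
      (three f g ▸ indep_lineMatroid (mask_lt _) hE h3' hl)

theorem not_isFrame_lineMatroidal (i : Fin 8) : ¬ (lineMatroidal i).IsFrame := by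
  intro h
  obtain ⟨p, h1, h2, h3⟩ := lineMatroidal_exists_incidence h
  fin_cases i
  -- For `i = 0, 1`, each two of `a`, `b`, `c` form a circuit with `e₁`, `e₂`, so exactly one of
  -- each two would be incident with `u₁`: a 2-colouring of a triangle.
  · have hab := h1 a b (by decide +kernel)
    have hac := h1 a c (by decide +kernel)
    have hbc := h1 b c (by decide +kernel)
    tauto
  · have hab := h1 a b (by decide +kernel)
    have hac := h1 a c (by decide +kernel)
    have hbc := h1 b c (by decide +kernel)
    tauto
  -- For `i = 2, 3`, exactly one of `a`, `c` is incident with `u₁`, yet the third rule forces both: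
  -- `c`, `d` are the alternatives opposite `a`, and `a`, `b` those opposite `c`.
  · have hac := h1 a c (by decide +kernel)
    have ha := h3 c d a (by decide +kernel)
    have hc := h3 a b c (by decide +kernel)
    tauto
  · have hac := h1 a c (by decide +kernel)
    have ha := h3 c d a (by decide +kernel)
    have hc := h3 a b c (by decide +kernel)
    tauto
  -- For `i = 4, 5, 6`, the lines `{e₁, a, b}` and `{e₁, c, d}` put both `a` and `d` at `u₁`, but
  -- only one of them can be there.
  · have had := h1 a d (by decide +kernel)
    have hab := h2 a b d c (by decide +kernel)
    have hcd := h2 c d b a (by decide +kernel)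
    tauto
  · have had := h1 a d (by decide +kernel)
    have hab := h2 a b d c (by decide +kernel)
    have hcd := h2 c d b a (by decide +kernel)
    tauto
  · have had := h1 a d (by decide +kernel)
    have hab := h2 a b d c (by decide +kernel)
    have hcd := h2 c d b a (by decide +kernel)
    tauto
  -- For `i = 7`, the line `{e₁, c, d}` puts `c` and `d` at `u₁`. Then `a` is not there because of
  -- `d`, so `b` is, which contradicts `c`.
  · have hab := h1 a b (by decide +kernel)
    have had := h1 a d (by decide +kernel)
    have hbc := h1 b c (by decide +kernel)
    have hcd := h2 c d b a (by decide +kernel)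
    tauto

/-! ### Proper minors -/

theorem eRank_delete_le {α : Type*} (M : Matroid α) (D : Set α) :
    (M.delete D).eRank ≤ M.eRank := by
  obtain ⟨B, hB⟩ := (M.delete D).exists_isBase
  rw [← hB.encard_eq_eRank]
  exact (Matroid.delete_indep_iff.1 hB.indep).1.encard_le_eRank

theorem eRank_contract_le_two {α : Type*} {M : Matroid α} {e : α} (he : M.IsNonloop e)
    (hM : M.eRank ≤ 3) : (M.contract {e}).eRank ≤ 2 := by
  obtain ⟨B, hB⟩ := (M.contract {e}).exists_isBase
  rw [← hB.encard_eq_eRank]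
  obtain ⟨heB, hi⟩ := he.contractElem_indep_iff.1 hB.indep
  have h := hi.encard_le_eRank.trans hM
  rw [encard_insert_of_notMem heB] at h
  exact (ENat.add_le_add_iff_right (k := 1) (by decide)).1 h

/-- The frame matroidals of rank at most three with at most two distinguished elements are closed
under minors. -/
theorem MinorStep.isFrame {α : Type*} {X Y : Matroidal α} {p q : α} (h : MinorStep X Y)
    (hX : X.IsFrame) (hr : X.matroid.eRank ≤ 3) (hL : X.L ⊆ {p, q}) :
    Y.IsFrame ∧ Y.matroid.eRank ≤ 3 ∧ Y.L ⊆ {p, q} := by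
  obtain ⟨e, he, hM, hL'⟩ | ⟨e, he, hM, hL'⟩ | ⟨e, he, hM, hL'⟩ := h
  · exact ⟨hX.of_delete hM hL', hM ▸ (eRank_delete_le _ _).trans hr, hL' ▸ hL⟩
  -- Contracting a loop is the same as deleting it, and contracting a nonloop lowers the rank to at
  -- most two. No contraction of biased graphs is needed.
  · obtain hl | hl := X.matroid.isLoop_or_isNonloop e he.1
    · rw [Matroid.contract_eq_delete_of_subset_loops (singleton_subset_iff.2 hl)] at hM
      exact ⟨hX.of_delete hM hL', hM ▸ (eRank_delete_le _ _).trans hr, hL' ▸ hL⟩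
    · have h2 : Y.matroid.eRank ≤ 2 := hM ▸ eRank_contract_le_two hl hr
      exact ⟨isFrame_of_eRank_le_two h2 (hL' ▸ hL), h2.trans (by decide), hL' ▸ hL⟩
  · have hs : Y.L ⊆ X.L := hL' ▸ sdiff_subset
    exact ⟨hX.mono hM hs, hM ▸ hr, hs.trans hL⟩

theorem IsMinor.isFrame {α : Type*} {X Y : Matroidal α} {p q : α} (h : Y.IsMinor X)
    (hX : X.IsFrame) (hr : X.matroid.eRank ≤ 3) (hL : X.L ⊆ {p, q}) :
    Y.IsFrame ∧ Y.matroid.eRank ≤ 3 ∧ Y.L ⊆ {p, q} := by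
  induction h with
  | refl => exact ⟨hX, hr, hL⟩
  | tail _ h ih => exact h.isFrame ih.1 ih.2.1 ih.2.2

/-- The graphs of `Ω₀, …, Ω₇`. -/
def omegaEnds : Fin 8 → Elt → Sym2 (Fin 3) :=
  ![endsA, endsA, endsB, endsA, endsC, endsC, endsC, endsD]

/-- The map on labels with the listed values. -/
def endsOfList (l : List (Sym2 (Fin 3))) (e : Elt) : Sym2 (Fin 3) := l.getD e.idx s(0, 0)

/-- For an element `f` outside `Lᵢ`, a graph in which `e₁` and `e₂` are loops and which, with
suitable balanced cycles, represents the matroid obtained from `Mᵢ` by deleting `f`. -/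
def deleteEnds (i : Fin 8) (f : Elt) : Elt → Sym2 (Fin 3) :=
  match i, f with
  | 0, c | 1, c | 4, b | 5, b | 7, b =>
    endsOfList [s(0, 0), s(1, 1), s(1, 2), s(0, 2), s(2, 2), s(0, 2)]
  | 2, a | 4, d | 5, d =>
    endsOfList [s(0, 0), s(1, 1), s(2, 2), s(0, 2), s(1, 2), s(2, 2)]
  | 2, b | 3, a | 3, b | 5, c | 6, c | 6, d =>
    endsOfList [s(0, 0), s(1, 1), s(0, 2), s(0, 2), s(1, 2), s(1, 2)]
  | 2, c =>
    endsOfList [s(0, 0), s(1, 1), s(1, 2), s(2, 2), s(0, 0), s(0, 2)]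
  | 4, a | 7, a =>
    endsOfList [s(0, 0), s(1, 1), s(1, 1), s(1, 2), s(0, 2), s(2, 2)]
  | 4, c =>
    endsOfList [s(0, 0), s(1, 1), s(0, 2), s(2, 2), s(1, 2), s(1, 2)]
  | 7, c =>
    endsOfList [s(0, 0), s(1, 1), s(0, 2), s(1, 2), s(1, 1), s(1, 2)]
  | 7, d =>
    endsOfList [s(0, 0), s(1, 1), s(1, 2), s(0, 2), s(1, 2), s(0, 0)]
  | _, _ =>
    endsOfList [s(0, 0), s(1, 1), s(1, 2), s(1, 2), s(0, 2), s(0, 2)]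

/-- A graph in which `e₂` is a loop and which, with suitable balanced cycles, represents `Mᵢ`. -/
def swapEnds (i : Fin 8) : Elt → Sym2 (Fin 3) :=
  match i with
  | 0 | 1 | 6 =>
    endsOfList [s(0, 2), s(1, 1), s(1, 2), s(0, 1), s(0, 2), s(0, 2)]
  | 2 | 3 =>
    endsOfList [s(0, 2), s(1, 1), s(0, 0), s(0, 1), s(1, 2), s(1, 2)]
  | 4 | 7 =>
    endsOfList [s(0, 2), s(1, 1), s(1, 2), s(0, 1), s(2, 2), s(0, 0)]
  | 5 =>
    endsOfList [s(0, 2), s(1, 1), s(0, 1), s(1, 2), s(0, 0), s(0, 2)]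

/-- The elements of the matroid obtained from `Mᵢ` by deleting `f`. -/
def deleteMask (i : Fin 8) (f : Elt) : ℕ := groundMask i &&& (63 ^^^ bit f)

theorem ofMask_deleteMask (i : Fin 8) (f : Elt) :
    ofMask (deleteMask i f) = ofMask (groundMask i) \ {f} := by
  have h : ofMask (63 ^^^ bit f) = {f}ᶜ := by
    ext e
    cases e <;> cases f <;> simp [mem_ofMask, bit, idx] <;> decide
  rw [deleteMask, ofMask_and, h]
  rfl

/-- The list of lines needs no pruning after the deletion: a line through `f` is neither equal to
nor contained in a set that avoids `f`. -/
theorem isCircuit_delete_lineMatroid {i : Fin 8} {f : Elt} {m : ℕ} (hm : m < 64) :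
    ((lineMatroid i).delete {f}).IsCircuit (ofMask m) ↔
      isLineCircuit (deleteMask i f) (lines i) m := by
  have h1 : m &&& deleteMask i f = m ↔ m &&& groundMask i = m ∧ m &&& bit f = 0 := by
    rw [← ofMask_subset hm, ← ofMask_subset hm, ofMask_deleteMask, subset_sdiff,
      ← disjoint_ofMask hm, ofMask_bit]
  rw [Matroid.delete_isCircuit_iff, isCircuit_lineMatroid hm, ← ofMask_bit, disjoint_ofMask hm]
  simp only [isLineCircuit, Bool.and_eq_true, beq_iff_eq, h1]
  tauto

/-- The `testBit` hypothesis excludes `f = d` for `i = 0, 1`, where `d` is not an element and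
`deleteEnds` only takes its default value. -/
theorem isBiased_deleteEnds : ∀ i, ∀ f ∈ [a, b, c, d], (groundMask i).testBit f.idx →
    isBiased (deleteMask i f) (deleteEnds i f) (isBalanced (deleteMask i f) (deleteEnds i f)
      (isLineCircuit (deleteMask i f) (lines i))) := by decide +kernel

theorem isFrame_deleteEnds : ∀ i, ∀ f ∈ [a, b, c, d], (groundMask i).testBit f.idx →
    isFrame (deleteMask i f) (deleteEnds i f) (isLineCircuit (deleteMask i f) (lines i)) := by
  decide +kernel

theorem isDiag_deleteEnds : ∀ i, ∀ f ∈ [a, b, c, d],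
    (deleteEnds i f e₁).IsDiag ∧ (deleteEnds i f e₂).IsDiag := by decide +kernel

theorem isBiased_omegaEnds : ∀ i, isBiased (groundMask i) (omegaEnds i)
    (isBalanced (groundMask i) (omegaEnds i) (isLineCircuit (groundMask i) (lines i))) := by
  decide +kernel

/-- Serves twice: for `M_i = F(Ω_i)`, and for the minor with `e₂` removed from `L`, as `e₁` is a
loop of `Ω_i`. -/
theorem isFrame_omegaEnds : ∀ i, isFrame (groundMask i) (omegaEnds i)
    (isLineCircuit (groundMask i) (lines i)) := by
  decide +kernel

theorem isDiag_omegaEnds : ∀ i, (omegaEnds i e₁).IsDiag := by decide +kernel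

theorem isBiased_swapEnds : ∀ i, isBiased (groundMask i) (swapEnds i)
    (isBalanced (groundMask i) (swapEnds i) (isLineCircuit (groundMask i) (lines i))) := by
  decide +kernel

theorem isFrame_swapEnds : ∀ i, isFrame (groundMask i) (swapEnds i)
    (isLineCircuit (groundMask i) (lines i)) := by
  decide +kernel

theorem isDiag_swapEnds : ∀ i, (swapEnds i e₂).IsDiag := by decide +kernel

theorem isFrame_of_minorStep_lineMatroidal {i : Fin 8} {Y : Matroidal Elt}
    (h : MinorStep (lineMatroidal i) Y) :
    Y.IsFrame ∧ Y.matroid.eRank ≤ 3 ∧ Y.L ⊆ {e₁, e₂} := by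
  have hr : (lineMatroidal i).matroid.eRank ≤ 3 := (eRank_lineMatroid i).le
  obtain ⟨f, hf, hM, hL⟩ | ⟨f, hf, hM, hL⟩ | ⟨f, hf, hM, hL⟩ := h
  · change Y.matroid = (lineMatroid i).delete {f} at hM
    change Y.L = {e₁, e₂} at hL
    refine ⟨?_, hM ▸ (eRank_delete_le _ _).trans hr, hL.le⟩
    have hf' : f ∈ [a, b, c, d] := by
      have h2 : f ∉ ({e₁, e₂} : Set Elt) := hf.2
      cases f <;> simp_all
    refine isFrame_matroidal (ends := deleteEnds i f) ?_
      (fun m hm ↦ by rw [hM, isCircuit_delete_lineMatroid hm])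
      (isBiased_deleteEnds i f hf' hf.1) (isFrame_deleteEnds i f hf' hf.1) ?_
    · rw [hM, ofMask_deleteMask]
      rfl
    · rw [hL]
      rintro e (rfl | rfl)
      exacts [(isDiag_deleteEnds i f hf').1, (isDiag_deleteEnds i f hf').2]
  -- Every element of `M_i` is a nonloop, so any contraction drops the rank to two.
  · have h2 : Y.matroid.eRank ≤ 2 := hM ▸ eRank_contract_le_two (isNonloop_lineMatroid hf.1) hr
    exact ⟨isFrame_of_eRank_le_two h2 hL.le, h2.trans (by decide), hL.le⟩
  · refine ⟨?_, hM ▸ hr, hL ▸ sdiff_subset⟩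
    have hE : Y.matroid.E = ofMask (groundMask i) := by rw [hM]; rfl
    have hc : ∀ m < 64, Y.matroid.IsCircuit (ofMask m) ↔
        isLineCircuit (groundMask i) (lines i) m := fun m hm ↦ by
      rw [hM]
      exact isCircuit_lineMatroid hm
    obtain rfl | rfl := hf
    · refine isFrame_matroidal hE hc (isBiased_swapEnds i) (isFrame_swapEnds i) ?_
      rw [hL]
      rintro e ⟨rfl | rfl, he⟩
      exacts [(he rfl).elim, isDiag_swapEnds i]
    · refine isFrame_matroidal hE hc (isBiased_omegaEnds i) (isFrame_omegaEnds i) ?_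
      rw [hL]
      rintro e ⟨rfl | rfl, he⟩
      exacts [isDiag_omegaEnds i, (he rfl).elim]

/-- A proper minor arises by at least one step. The result of that step is frame, of rank at most
three and with `L ⊆ {e₁, e₂}`, and these properties persist under further steps. -/
theorem isExcludedMinor_lineMatroidal (i : Fin 8) :
    (lineMatroidal i).IsExcludedMinor IsFrame := by
  refine ⟨not_isFrame_lineMatroidal i, fun Y hY hne ↦ ?_⟩
  obtain h | ⟨Z, hZ, hYZ⟩ := hY.cases_head
  · exact (hne h.symm).elim
  · obtain ⟨h1, h2, h3⟩ := isFrame_of_minorStep_lineMatroidal hZ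
    exact (IsMinor.isFrame hYZ h1 h2 h3).1

end Matroidal

/-! ### The matroids are represented by `Ω₀, …, Ω₇` -/

namespace BiasedGraph

open Elt MaskGraph Matroidal

/-- The masks of the balanced cycles of `Ω₀, …, Ω₇`. -/
def balancedMasks : Fin 8 → List ℕ :=
  ![[mask [a, c, b]], [], [mask [a, e₂, b]], [mask [a, e₂, b]],
    [mask [a, e₂, c], mask [b, e₂, d]], [mask [a, e₂, c]], [], [mask [e₂, a, c], mask [e₂, b, d]]]

/-- The cycles declared balanced in `Ω_i` are exactly the cycles that are circuits of `lineMatroid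
i`, as `represents_of_isFrame` demands. -/
theorem mem_balancedMasks : ∀ i, ∀ m ∈ List.range 64, m ∈ balancedMasks i ↔
    isBalanced (groundMask i) (omegaEnds i) (isLineCircuit (groundMask i) (lines i)) m := by
  decide +kernel

theorem balancedMasks_lt : ∀ i, ∀ m ∈ balancedMasks i, m < 64 := by decide +kernel

theorem graph_Omega (i : Fin 8) :
    (Omega i).graph = MaskGraph.graph (groundMask i) (omegaEnds i) := by
  have h31 : ofMask 31 = {d}ᶜ := by
    ext e
    cases e <;> simp [mem_ofMask, idx] <;> decide
  have h63 : ofMask 63 = univ := by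
    ext e
    cases e <;> simp [mem_ofMask, idx] <;> decide
  fin_cases i
  · exact congrArg (Graph.ofEnds · endsA) h31.symm
  · exact congrArg (Graph.ofEnds · endsA) h31.symm
  · exact congrArg (Graph.ofEnds · endsB) h63.symm
  · exact congrArg (Graph.ofEnds · endsA) h63.symm
  · exact congrArg (Graph.ofEnds · endsC) h63.symm
  · exact congrArg (Graph.ofEnds · endsC) h63.symm
  · exact congrArg (Graph.ofEnds · endsC) h63.symm
  · exact congrArg (Graph.ofEnds · endsD) h63.symm

theorem balanced_Omega (i : Fin 8) :
    (Omega i).balanced = {X | ∃ m ∈ balancedMasks i, ofMask m = X} := by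
  have three : ∀ e f g : Elt, ofMask (mask [e, f, g]) = {e, f, g} := fun e f g ↦ by
    rw [ofMask_mask]; ext; simp
  fin_cases i <;> ext X <;>
    simp [Omega, Omega0, Omega1, Omega2, Omega3, Omega4, Omega5, Omega6, Omega7, balancedMasks,
      oneBalanced, twoBalanced, contrabalanced, three, eq_comm]

theorem represents_Omega (i : Fin 8) : (Omega i).Represents (lineMatroid i) := by
  refine represents_of_isFrame (graph_Omega i) rfl (fun m hm ↦ isCircuit_lineMatroid hm)
    (fun m hm ↦ ?_) (isFrame_omegaEnds i)
  rw [← mem_balancedMasks i m (List.mem_range.2 hm), balanced_Omega]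
  constructor
  · rintro ⟨n, hn, h⟩
    rwa [← (ofMask_injOn (balancedMasks_lt i n hn) hm).1 h]
  · exact fun h ↦ ⟨m, h, rfl⟩

end BiasedGraph

/-- By `Represents.unique` the matroid of `X` can only be `F(Ω_i)`, so the existential statement is
about `(M_i, L_i)` itself. -/
theorem mainTheorem10 (i : Fin 8) :
    ∃ X : Matroidal Elt,
      (BiasedGraph.Omega i).Represents X.matroid ∧
      X.L = {Elt.e₁, Elt.e₂} ∧
      X.matroid.eRank = 3 ∧
      X.IsExcludedMinor Matroidal.IsFrame :=
  ⟨Matroidal.lineMatroidal i, BiasedGraph.represents_Omega i, rfl, Matroidal.eRank_lineMatroid i,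
    Matroidal.isExcludedMinor_lineMatroidal i⟩
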